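/- Let $M$ be a smooth finite-dimensional manifold, with tangent bundles $TM$, $T^2M=T(TM)$, $T^3M=T(T^2M)$. Let $GL(TM)\rightrightarrows M$ be the groupoid of all linear isomorphisms between tangent spaces of $M$. A smooth local bisection $b$ of it near $x$ is a diffeomorphism $b^0$ from a neighbourhood of $x$ onto an open subset of $M$, together with linear isomorphisms $b(x'):T_{x'}M\to T_{b^0(x')}M$ depending smoothly on $x'$. A $(1,1)$-jet at $x$ is the 1-jet $j^1_xb$ of such a $b$ (equality of values and of first derivatives at $x$ in coordinates); put $p(j^1_xb)=b(x)$ and $p_*(j^1_xb)=(b^0)_{*x}$. It acts on the fibre $T^2_xM$ of $T^2M$ over $x$ by $j^1_xb\cdot\frac{dX_t}{dt}\big|_0=\frac{d(b\cdot X_t)}{dt}\big|_0$. A symmetry jet on $M$ is a smooth section $\mathfrak s$, $x\mapsto\mathfrak s(x)$, of the bundle of $(1,1)$-jets (source $x$) with $p(\mathfrak s(x))=p_*(\mathfrak s(x))=-I_x$ for all $x$. Its associated affine connection is $$(\nabla_XY)_x=\tfrac12\,[X,\,Y+s_x(Y)]_x ,$$ where $s_x$ is a local bisection with $j^1_xs_x=\mathfrak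 s(x)$ and $s_x(Y)_{s_x^0(x')}=s_x(x')Y_{x'}$. Its curvature is $R(X,Y)Z=\nabla_X\nabla_YZ-\nabla_Y\nabla_XZ-\nabla_{[X,Y]}Z$. The 1-jets of $\mathfrak s$ act on $T^3M$ by $j^1_x\mathfrak s\cdot\frac{d\mathcal X_t}{dt}\big|_0=\frac{d(\mathfrak s(x_t)\cdot\mathcal X_t)}{dt}\big|_0$, for paths $\mathcal X_t$ in $T^2M$ lying over paths $x_t$ in $M$ with $x_0=x$. Let $\kappa$ be the canonical involution of $T^3M=T^2(TM)$ (for a manifold $N$, the one of $T^2N$ is $(x,u,v,w)\mapsto(x,v,u,w)$ in induced coordinates), and set $\kappa(j^1_x\mathfrak s)\cdot\mathfrak X=\kappa\big(j^1_x\mathfrak s\cdot\kappa(\mathfrak X)\big)$. Let $\mathcal P=(p,p_*,p_{**}):T^3M\to (T^2M)^3$, where $p:T^3M\to T^2M$ is the canonical projection, $p_*$ the differential of the canonical projection $T^2M\to TM$, and $p_{**}$ the second differential of $TM\to M$. The fibres of $\mathcal P$ over $x\in M$ are affine spaces modelled on $T_xM$: $V\in T_xM$ acts by $$\mathfrak X\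 \mapsto\ \mathfrak X+\frac{d}{dt}\Big|_{0}\Big(\mathcal Z+t\,\frac{d}{ds}\Big|_{0}(u+sV)\Big),$$ where $\mathcal Z\in T^2M$ is the base point of $\mathfrak X$ and $u\in T_xM$ that of $\mathcal Z$. For $\mathfrak X_1,\mathfrak X_2$ in one $\mathcal P$-fibre, $\Pi(\mathfrak X_1,\mathfrak X_2)\in T_xM$ is the vector taking $\mathfrak X_2$ to $\mathfrak X_1$. **Theorem.** Let $\mathfrak s$ be a symmetry jet on $M$, let $X,Y,Z$ be smooth vector fields on $M$, let $x\in M$, and let $\mathfrak X=Z_{**}Y_{*}X_x\in T^3M$ (vector fields being regarded as maps $M\to TM$). Then $\kappa(j^1_x\mathfrak s)\cdot j^1_x\mathfrak s\cdot\mathfrak X$ and $j^1_x\mathfrak s\cdot\kappa(j^1_x\mathfrak s)\cdot\mathfrak X$ lie in the same fibre of $\mathcal P$, and the curvature of the connection associated to $\mathfrak s$ satisfies $$R(X_x,Y_x)Z_x=\tfrac14\,\Pi\big(\kappa(j^1_x\mathfrak s)\cdot j^1_x\mathfrak s\cdot\mathfrak X,\ j^1_x\mathfrak s\cdot\kappa(j^1_x\mathfrak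 s)\cdot\mathfrak X\big).$$ -/

import Mathlib

open Bundle Set Filter
open scoped Manifold ContDiff Topology

noncomputable section

namespace SymJet

/-! ### The iterated tangent bundles -/

/-- `TM`. -/
abbrev T1 (E M : Type*) [NormedAddCommGroup E] [NormedSpace ℝ E] [TopologicalSpace M]
    [ChartedSpace E M] : Type _ :=
  TangentBundle 𝓘(ℝ, E) M

/-- `T²M = T(TM)`. -/
abbrev T2 (E M : Type*) [NormedAddCommGroup E] [NormedSpace ℝ E] [TopologicalSpace M]
    [ChartedSpace E M] [IsManifold 𝓘(ℝ, E) ∞ M] : Type _ :=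
  TangentBundle 𝓘(ℝ, E).tangent (T1 E M)

/-- `T³M = T(T²M)`. -/
abbrev T3 (E M : Type*) [NormedAddCommGroup E] [NormedSpace ℝ E] [TopologicalSpace M]
    [ChartedSpace E M] [IsManifold 𝓘(ℝ, E) ∞ M] : Type _ :=
  TangentBundle 𝓘(ℝ, E).tangent.tangent (T2 E M)

section general

variable {E : Type*} [NormedAddCommGroup E] [NormedSpace ℝ E]
  {H : Type*} [TopologicalSpace H] (I : ModelWithCorners ℝ E H)
  {N : Type*} [TopologicalSpace N] [ChartedSpace H N] [IsManifold I 1 N]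

/-- The canonical involution `κ` of `T²N`, `κ(x, u, v, w) = (x, v, u, w)` in the coordinates of
`T²N` induced by local coordinates of `N` around `x`.
In Mathlib, an element of `T²N` is `⟨⟨x, u⟩, (v, w)⟩`, where `u` is read in the preferred chart of
`N` at `x`, and `(v, w)` in the preferred chart of `TN` at `⟨x, u⟩`, which is the one
induced by the preferred chart of `N` at `x`: the entries are exactly the induced coordinates. -/
def kappa (ξ : TangentBundle I.tangent (TangentBundle I N)) :
    TangentBundle I.tangent (TangentBundle I N) :=
  ⟨⟨ξ.1.1, Prod.fst (α := E) (β := E) ξ.2⟩, ((ξ.1.2, Prod.snd (α := E) (β := E) ξ.2) : E × E)⟩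

/-- The vertical lift of `V ∈ T_x N` at `u ∈ T_x N`: the velocity at `t = 0` of `t ↦ u + t V`. -/
def vlift (u : TangentBundle I N) (V : TangentSpace I u.1) : TangentSpace I.tangent u :=
  mfderiv 𝓘(ℝ, ℝ) I.tangent (fun t : ℝ => (⟨u.1, u.2 + t • V⟩ : TangentBundle I N)) 0 (1 : ℝ)

end general

variable {E : Type*} [NormedAddCommGroup E] [NormedSpace ℝ E]
  {M : Type*} [TopologicalSpace M] [ChartedSpace E M] [IsManifold 𝓘(ℝ, E) ∞ M]

/-! ### The affine fibration of `T³M` over its three projections to `T²M` -/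

/-- The projection `p_* : T²M → TM`, the differential of `p : TM → M`. -/
def pStarTwo : T2 E M → T1 E M :=
  tangentMap 𝓘(ℝ, E).tangent 𝓘(ℝ, E) (fun v : T1 E M => v.1)

/-- The projection `p_* : T³M → T²M`, the differential of `p : T²M → TM`. -/
def pStar : T3 E M → T2 E M :=
  tangentMap 𝓘(ℝ, E).tangent.tangent 𝓘(ℝ, E).tangent (fun ξ : T2 E M => ξ.1)

/-- The projection `p_** : T³M → T²M`, the differential of `p_* : T²M → TM`. -/
def pStarStar : T3 E M → T2 E M :=
  tangentMap 𝓘(ℝ, E).tangent.tangent 𝓘(ℝ, E).tangent (pStarTwo (E := E) (M := M))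

/-- `𝒫 = (p, p_*, p_**) : T³M → T²M × T²M × T²M`. -/
def projections (ζ : T3 E M) : T2 E M × T2 E M × T2 E M :=
  (ζ.1, pStar ζ, pStarStar ζ)

/-- The parameterization by `T_x M` of the `𝒫`-fibre through `ζ ∈ T³M`: with `ξ = p(ζ) ∈ T²M` and
`u = p(ξ) ∈ TM`, the vector `V ∈ T_x M` acts by
`ζ ↦ ζ + d/dt (ξ + t d/ds (u + s V)|_{s=0})|_{t=0}`. -/
def translate (ζ : T3 E M) (V : TangentSpace 𝓘(ℝ, E) ζ.1.1.1) : T3 E M :=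
  ⟨ζ.1, ζ.2 + vlift 𝓘(ℝ, E).tangent ζ.1 (vlift 𝓘(ℝ, E) ζ.1.1 V)⟩

open Classical in
/-- The difference map `Π : T³M ×_{𝒫} T³M → TM`: `Π(ζ₁, ζ₂)` is the `V` with
`ζ₁ = translate ζ₂ V` (and zero when there is none, that is, off a common `𝒫`-fibre). -/
def Pi3 (ζ₁ ζ₂ : T3 E M) : T1 E M :=
  ⟨ζ₂.1.1.1, if h : ∃ V, ζ₁ = translate ζ₂ V then h.choose else 0⟩

/-- Scalar multiplication `m_a` on `TM`. -/
def scale (a : ℝ) (v : T1 E M) : T1 E M := ⟨v.1, a • v.2⟩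

/-! ### Jets of local bisections of the groupoid of linear isomorphisms of tangent spaces -/

/-- A smooth local bisection, defined near `x`, of the groupoid `GL(TM)` of all linear
isomorphisms `T_y M → T_{y'} M`: a local diffeomorphism `base` of `M` and a
smooth family of linear isomorphisms `lin y : T_y M → T_{base y} M`, `y ∈ base.source ∋ x`. -/
structure LocalBisection (E : Type*) [NormedAddCommGroup E] [NormedSpace ℝ E] {M : Type*}
    [TopologicalSpace M] [ChartedSpace E M] [IsManifold 𝓘(ℝ, E) ∞ M] (x : M) where
  /-- the underlying local diffeomorphism -/
  base : OpenPartialHomeomorph M M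
  mem_source : x ∈ base.source
  contMDiffOn_base : ContMDiffOn 𝓘(ℝ, E) 𝓘(ℝ, E) ∞ base base.source
  contMDiffOn_base_symm : ContMDiffOn 𝓘(ℝ, E) 𝓘(ℝ, E) ∞ base.symm base.target
  /-- the linear maps between tangent spaces -/
  lin : ∀ y : M, TangentSpace 𝓘(ℝ, E) y →L[ℝ] TangentSpace 𝓘(ℝ, E) (base y)
  bijective_lin : ∀ y ∈ base.source, Function.Bijective (lin y)
  contMDiffAt_lin : ∀ y ∈ base.source, ContMDiffAt 𝓘(ℝ, E) 𝓘(ℝ, E →L[ℝ] E) ∞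
    (fun z => ContinuousLinearMap.inCoordinates E (TangentSpace 𝓘(ℝ, E) (M := M))
      E (TangentSpace 𝓘(ℝ, E) (M := M)) y z (base y) (base z) (lin z)) y

namespace LocalBisection

variable {x : M}

/-- The action `v ↦ b · v` of a local bisection on tangent vectors. -/
def toFun (b : LocalBisection E x) (v : T1 E M) : T1 E M := ⟨b.base v.1, b.lin v.1 v.2⟩

/-- A local bisection in coordinates: the chart of `M` at `x` in the source and, in the target,
the coordinates `(y', matrix)` of `GL(TM)` given by the charts of `M` at `x` and at `y`. -/
def coord (b : LocalBisection E x) (y : M) (z : E) : E × (E →L[ℝ] E) :=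
  (extChartAt 𝓘(ℝ, E) y (b.base ((extChartAt 𝓘(ℝ, E) x).symm z)),
    ContinuousLinearMap.inCoordinates E (TangentSpace 𝓘(ℝ, E) (M := M))
      E (TangentSpace 𝓘(ℝ, E) (M := M)) x ((extChartAt 𝓘(ℝ, E) x).symm z) y
      (b.base ((extChartAt 𝓘(ℝ, E) x).symm z)) (b.lin ((extChartAt 𝓘(ℝ, E) x).symm z)))

/-- The relation `j¹_x b₁ = j¹_x b₂`: the isomorphisms `b₁(x)` and `b₂(x)` are equal, and `b₁`
and `b₂` have the same first derivative at `x` in coordinates around `x` and `b₁(x)`. -/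
def JetRel (b₁ b₂ : LocalBisection E x) : Prop :=
  (∀ u : TangentSpace 𝓘(ℝ, E) x, b₁.toFun ⟨x, u⟩ = b₂.toFun ⟨x, u⟩) ∧
  fderiv ℝ (b₁.coord (b₁.base x)) (extChartAt 𝓘(ℝ, E) x x) =
    fderiv ℝ (b₂.coord (b₁.base x)) (extChartAt 𝓘(ℝ, E) x x)

theorem JetRel.base_eq {b₁ b₂ : LocalBisection E x} (h : JetRel b₁ b₂) :
    b₁.base x = b₂.base x :=
  congrArg (fun v : T1 E M => v.1) (h.1 0)

/-- Equality of 1-jets at `x`. -/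
def jetSetoid (E : Type*) [NormedAddCommGroup E] [NormedSpace ℝ E] {M : Type*}
    [TopologicalSpace M] [ChartedSpace E M] [IsManifold 𝓘(ℝ, E) ∞ M] (x : M) :
    Setoid (LocalBisection E x) where
  r := JetRel
  iseqv :=
    { refl := fun _ => ⟨fun _ => rfl, rfl⟩
      symm := fun {b₁ b₂} h => ⟨fun u => (h.1 u).symm, by rw [← h.base_eq]; exact h.2.symm⟩
      trans := fun {b₁ b₂ b₃} h h' =>
        ⟨fun u => (h.1 u).trans (h'.1 u), by rw [h.2, h.base_eq]; exact h'.2⟩ }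

theorem mdifferentiableAt_toFun (b : LocalBisection E x) (u : TangentSpace 𝓘(ℝ, E) x) :
    MDifferentiableAt 𝓘(ℝ, E).tangent 𝓘(ℝ, E).tangent b.toFun (⟨x, u⟩ : T1 E M) := by
  have hp : ContMDiffAt 𝓘(ℝ, E).tangent 𝓘(ℝ, E) ∞ (fun v : T1 E M => v.1) ⟨x, u⟩ :=
    Bundle.contMDiffAt_proj _
  have h1 : ContMDiffAt 𝓘(ℝ, E).tangent 𝓘(ℝ, E →L[ℝ] E) ∞
      (fun v : T1 E M => ContinuousLinearMap.inCoordinates E (TangentSpace 𝓘(ℝ, E) (M := M))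
        E (TangentSpace 𝓘(ℝ, E) (M := M)) x v.1 (b.base x) (b.base v.1) (b.lin v.1)) ⟨x, u⟩ :=
    ContMDiffAt.comp (g := fun z => ContinuousLinearMap.inCoordinates E
      (TangentSpace 𝓘(ℝ, E) (M := M)) E (TangentSpace 𝓘(ℝ, E) (M := M)) x z (b.base x) (b.base z)
      (b.lin z)) (⟨x, u⟩ : T1 E M) (b.contMDiffAt_lin x b.mem_source) hp
  have hb : ContMDiffAt 𝓘(ℝ, E).tangent 𝓘(ℝ, E) ∞ (fun v : T1 E M => b.base v.1) ⟨x, u⟩ :=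
    ContMDiffAt.comp (g := b.base) (⟨x, u⟩ : T1 E M)
      (b.contMDiffOn_base.contMDiffAt (b.base.open_source.mem_nhds b.mem_source)) hp
  have hv : ContMDiffAt 𝓘(ℝ, E).tangent 𝓘(ℝ, E).tangent ∞
    (fun v : T1 E M => (⟨v.1, v.2⟩ : T1 E M)) ⟨x, u⟩ := contMDiffAt_id
  have key : ContMDiffAt 𝓘(ℝ, E).tangent 𝓘(ℝ, E).tangent ∞ b.toFun (⟨x, u⟩ : T1 E M) :=
    ContMDiffAt.clm_apply_of_inCoordinates (b₁ := fun v : T1 E M => v.1)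
    (b₂ := fun v : T1 E M => b.base v.1) (ϕ := fun v : T1 E M => b.lin v.1)
    (v := fun v : T1 E M => v.2) h1 hv hb
  exact key.mdifferentiableAt (by simp)

theorem differentiableAt_coord (b : LocalBisection E x) :
    DifferentiableAt ℝ (b.coord (b.base x)) (extChartAt 𝓘(ℝ, E) x x) := by
  have h1 := (b.contMDiffAt_lin x b.mem_source).mdifferentiableAt (by simp)
  have h2 := (b.contMDiffOn_base.contMDiffAt
    (b.base.open_source.mem_nhds b.mem_source)).mdifferentiableAt (by simp)
  have h1' := h1.differentiableWithinAt_writtenInExtChartAt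
  have h2' := h2.differentiableWithinAt_writtenInExtChartAt
  simp only [modelWithCornersSelf_coe, range_id, differentiableWithinAt_univ] at h1' h2'
  exact h2'.prodMk h1'

theorem written_toFun (b : LocalBisection E x) (u : TangentSpace 𝓘(ℝ, E) x) :
    writtenInExtChartAt 𝓘(ℝ, E).tangent 𝓘(ℝ, E).tangent (⟨x, u⟩ : T1 E M) b.toFun
      =ᶠ[𝓝 ((extChartAt 𝓘(ℝ, E) x x, u) : E × E)]
    fun q => ((b.coord (b.base x) q.1).1, (b.coord (b.base x) q.1).2 q.2) := by
  have hsrc : ∀ᶠ z in 𝓝 (extChartAt 𝓘(ℝ, E) x x),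
      z ∈ (extChartAt 𝓘(ℝ, E) x).target ∧
      (extChartAt 𝓘(ℝ, E) x).symm z ∈ b.base.source ∧
      b.base ((extChartAt 𝓘(ℝ, E) x).symm z) ∈ (chartAt E (b.base x)).source := by
    have hc := continuousAt_extChartAt_symm (I := 𝓘(ℝ, E)) x
    have hx : (extChartAt 𝓘(ℝ, E) x).symm (extChartAt 𝓘(ℝ, E) x x) = x := extChartAt_to_inv x
    have e1 := extChartAt_target_mem_nhds (I := 𝓘(ℝ, E)) x
    have e2 := hc.preimage_mem_nhds
      (t := b.base.source) (by rw [hx]; exact b.base.open_source.mem_nhds b.mem_source)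
    have hb : ContinuousAt b.base ((extChartAt 𝓘(ℝ, E) x).symm (extChartAt 𝓘(ℝ, E) x x)) := by
      rw [hx]; exact b.base.continuousAt b.mem_source
    have e3 := (hb.comp hc).preimage_mem_nhds (t := (chartAt E (b.base x)).source) (by
      simp only [Function.comp, hx]; exact chart_source_mem_nhds E _)
    filter_upwards [e1, e2, e3] with z h1 h2 h3 using ⟨h1, h2, h3⟩
  have h : ∀ᶠ q : E × E in 𝓝 (extChartAt 𝓘(ℝ, E) x x, u), _ :=
    (continuous_fst (X := E) (Y := E)).continuousAt.eventually hsrc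
  filter_upwards [h] with q hq
  obtain ⟨h1, h2, h3⟩ := hq
  have hm : (extChartAt 𝓘(ℝ, E) x).symm q.1 ∈ (chartAt E x).source := by
    simpa using (extChartAt 𝓘(ℝ, E) x).map_target h1
  have hs : (extChartAt 𝓘(ℝ, E).tangent (⟨x, u⟩ : T1 E M)).symm q
      = ⟨(extChartAt 𝓘(ℝ, E) x).symm q.1,
          (trivializationAt E (TangentSpace 𝓘(ℝ, E)) x).symmL ℝ
            ((extChartAt 𝓘(ℝ, E) x).symm q.1) q.2⟩ := by
    rw [FiberBundle.extChartAt]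
    rw [Trivialization.symmL_apply _ hm]
    exact ((trivializationAt E (TangentSpace 𝓘(ℝ, E)) x).mk_symm hm q.2).symm
  rw [writtenInExtChartAt, Function.comp_apply, Function.comp_apply, hs, FiberBundle.extChartAt]
  refine Prod.ext rfl ?_
  simp only [coord, ContinuousLinearMap.inCoordinates, ContinuousLinearMap.comp_apply]
  rw [Trivialization.continuousLinearMapAt_apply, Trivialization.coe_linearMapAt_of_mem]
  · rfl
  · exact h3

/-- The derivative of the action on `TM`, in coordinates. -/
theorem mfderiv_toFun (b : LocalBisection E x) (u : TangentSpace 𝓘(ℝ, E) x) :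
    (mfderiv 𝓘(ℝ, E).tangent 𝓘(ℝ, E).tangent b.toFun (⟨x, u⟩ : T1 E M) : E × E →L[ℝ] E × E) =
    fderiv ℝ (fun q : E × E => ((b.coord (b.base x) q.1).1, (b.coord (b.base x) q.1).2 q.2))
      (extChartAt 𝓘(ℝ, E) x x, u) := by
  have h1 : extChartAt 𝓘(ℝ, E).tangent (⟨x, u⟩ : T1 E M) ⟨x, u⟩ = (extChartAt 𝓘(ℝ, E) x x, u) := by
    rw [FiberBundle.extChartAt]
    refine Prod.ext rfl ?_
    exact tangentCoordChange_self (I := 𝓘(ℝ, E)) (mem_extChartAt_source x)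
  have h2 : range (𝓘(ℝ, E).tangent : E × E → E × E) = univ := by
    simp [ModelWithCorners.tangent]
  refine (b.mdifferentiableAt_toFun u).mfderiv.trans ?_
  rw [h1, h2, fderivWithin_univ]
  exact (b.written_toFun u).fderiv_eq

theorem JetRel.coord_eq {b₁ b₂ : LocalBisection E x} (h : JetRel b₁ b₂) :
    b₁.coord (b₁.base x) (extChartAt 𝓘(ℝ, E) x x)
      = b₂.coord (b₁.base x) (extChartAt 𝓘(ℝ, E) x x) := by
  have hx : (extChartAt 𝓘(ℝ, E) x).symm (extChartAt 𝓘(ℝ, E) x x) = x := extChartAt_to_inv x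
  refine Prod.ext ?_ (ContinuousLinearMap.ext fun w => ?_)
  · simp only [coord, hx, h.base_eq]
  · simp only [coord, ContinuousLinearMap.inCoordinates, ContinuousLinearMap.comp_apply]
    have key : ∀ v w : T1 E M, v = w →
      (trivializationAt E (TangentSpace 𝓘(ℝ, E)) (b₁.base x)).continuousLinearMapAt ℝ v.1 v.2 =
      (trivializationAt E (TangentSpace 𝓘(ℝ, E)) (b₁.base x)).continuousLinearMapAt ℝ w.1 w.2 := by
      rintro v _ rfl; rfl
    have hm : ∀ m : M, m = x → ∀ u : TangentSpace 𝓘(ℝ, E) m,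
        b₁.toFun ⟨m, u⟩ = b₂.toFun ⟨m, u⟩ := by
      rintro m hm
      rw [hm]
      exact h.1
    exact key _ _ (hm _ hx ((trivializationAt E (TangentSpace 𝓘(ℝ, E)) x).symmL ℝ _ w))

theorem T2_ext {ξ η : T2 E M} (h : ξ.1 = η.1)
    (h' : @Eq (E × E) ξ.2 η.2) : ξ = η := by
  obtain ⟨v, a⟩ := ξ
  obtain ⟨w, c⟩ := η
  obtain rfl : v = w := h
  obtain rfl : a = c := h'
  rfl

/-- The action on `T²M` of a local bisection depends on the bisection only through its 1-jet. -/
theorem JetRel.tangentMap_eq {b₁ b₂ : LocalBisection E x} (h : JetRel b₁ b₂)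
    (u : TangentSpace 𝓘(ℝ, E) x) (ξ : TangentSpace 𝓘(ℝ, E).tangent (⟨x, u⟩ : T1 E M)) :
    tangentMap 𝓘(ℝ, E).tangent 𝓘(ℝ, E).tangent b₁.toFun ⟨⟨x, u⟩, ξ⟩ =
    tangentMap 𝓘(ℝ, E).tangent 𝓘(ℝ, E).tangent b₂.toFun ⟨⟨x, u⟩, ξ⟩ := by
  refine T2_ext (h.1 u) ?_
  have e : (mfderiv 𝓘(ℝ, E).tangent 𝓘(ℝ, E).tangent b₁.toFun (⟨x, u⟩ : T1 E M) :
      E × E →L[ℝ] E × E) =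
      (mfderiv 𝓘(ℝ, E).tangent 𝓘(ℝ, E).tangent b₂.toFun (⟨x, u⟩ : T1 E M) :
      E × E →L[ℝ] E × E) := by
    refine (b₁.mfderiv_toFun u).trans (Eq.trans ?_ (b₂.mfderiv_toFun u).symm)
    have d₁ := b₁.differentiableAt_coord
    have d₂ := b₂.differentiableAt_coord
    rw [← h.base_eq] at d₂ ⊢
    have f₁ := d₁.hasFDerivAt
    have f₂ := d₂.hasFDerivAt
    rw [← h.2] at f₂
    have g : ∀ (u : E) {c : E → E × (E →L[ℝ] E)} {c'}, HasFDerivAt c c' (extChartAt 𝓘(ℝ, E) x x) →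
      c (extChartAt 𝓘(ℝ, E) x x) = b₁.coord (b₁.base x) (extChartAt 𝓘(ℝ, E) x x) →
      fderiv ℝ (fun q : E × E => ((c q.1).1, (c q.1).2 q.2)) (extChartAt 𝓘(ℝ, E) x x, u) =
      ((ContinuousLinearMap.fst ℝ _ _).comp (c'.comp (ContinuousLinearMap.fst ℝ E E))).prod
        ((b₁.coord (b₁.base x) (extChartAt 𝓘(ℝ, E) x x)).2.comp (ContinuousLinearMap.snd ℝ E E) +
        ((ContinuousLinearMap.snd ℝ _ _).comp (c'.comp (ContinuousLinearMap.fst ℝ E E))).flip u) := by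
      intro u c c' hc h0
      have hf : HasFDerivAt (fun q : E × E => c q.1) (c'.comp (ContinuousLinearMap.fst ℝ E E))
          (extChartAt 𝓘(ℝ, E) x x, u) :=
        HasFDerivAt.comp (g := c) (f := Prod.fst) (extChartAt 𝓘(ℝ, E) x x, u) hc hasFDerivAt_fst
      have := hf.fst.prodMk (hf.snd.clm_apply (hasFDerivAt_snd (p := (extChartAt 𝓘(ℝ, E) x x, u))))
      rw [← h0]
      exact this.fderiv
    exact (g u f₁ rfl).trans (g u f₂ h.coord_eq.symm).symm
  exact congrArg (fun L : E × E →L[ℝ] E × E => L (show E × E from ξ)) e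

/-- The differential of the underlying local diffeomorphism depends only on the 1-jet. -/
theorem JetRel.tangentMap_base_eq {b₁ b₂ : LocalBisection E x} (h : JetRel b₁ b₂)
    (V : TangentSpace 𝓘(ℝ, E) x) :
    tangentMap 𝓘(ℝ, E) 𝓘(ℝ, E) b₁.base ⟨x, V⟩ = tangentMap 𝓘(ℝ, E) 𝓘(ℝ, E) b₂.base ⟨x, V⟩ := by
  have g : ∀ b : LocalBisection E x,
      (mfderiv 𝓘(ℝ, E) 𝓘(ℝ, E) b.base x : E →L[ℝ] E) =
      (ContinuousLinearMap.fst ℝ _ _).comp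
        (fderiv ℝ (b.coord (b.base x)) (extChartAt 𝓘(ℝ, E) x x)) := by
    intro b
    have hd := (b.contMDiffOn_base.contMDiffAt
      (b.base.open_source.mem_nhds b.mem_source)).mdifferentiableAt (by simp)
    refine hd.mfderiv.trans ?_
    have hr : range (𝓘(ℝ, E) : E → E) = univ := by simp
    rw [hr, fderivWithin_univ]
    exact b.differentiableAt_coord.hasFDerivAt.fst.fderiv
  have e : (mfderiv 𝓘(ℝ, E) 𝓘(ℝ, E) b₁.base x : E →L[ℝ] E) =
      (mfderiv 𝓘(ℝ, E) 𝓘(ℝ, E) b₂.base x : E →L[ℝ] E) := by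
    refine (g b₁).trans (Eq.trans ?_ (g b₂).symm)
    rw [h.2, h.base_eq]
  have key : ∀ v w : T1 E M, v.1 = w.1 → (show E from v.2) = (show E from w.2) → v = w := by
    rintro ⟨v, a⟩ ⟨w, c⟩ h1 h2
    obtain rfl : v = w := h1
    obtain rfl : a = c := h2
    rfl
  exact key _ _ h.base_eq (congrArg (fun L : E →L[ℝ] E => L (show E from V)) e)

/-- The image `b Y` of a vector field `Y` under a local bisection `b`, a vector field on the
target of `b.base`: `(b Y)_{y'} = b(y) Y_y` for `y' = b.base y`. (Zero off the target.) -/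
def pushforward (b : LocalBisection E x) (Y : ∀ y : M, TangentSpace 𝓘(ℝ, E) y) (y' : M) :
    TangentSpace 𝓘(ℝ, E) y' :=
  open Classical in
  if h : y' ∈ b.base.target then
    b.base.right_inv h ▸ b.lin (b.base.symm y') (Y (b.base.symm y'))
  else 0

end LocalBisection

/-- The `(1,1)`-jets with source `x`: the 1-jets at `x` of local bisections of `GL(TM)`. -/
def Jet (E : Type*) [NormedAddCommGroup E] [NormedSpace ℝ E] {M : Type*}
    [TopologicalSpace M] [ChartedSpace E M] [IsManifold 𝓘(ℝ, E) ∞ M] (x : M) : Type _ :=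
  Quotient (LocalBisection.jetSetoid E x)

namespace Jet

variable {x : M}

/-- The first order part `p(j¹_x b) = b(x)`, as a map `T_x M → TM`. -/
def p (j : Jet E x) (V : TangentSpace 𝓘(ℝ, E) x) : T1 E M :=
  Quotient.lift (s := LocalBisection.jetSetoid E x) (fun b => b.toFun ⟨x, V⟩)
    (fun _ _ h => h.1 V) j

/-- The first order part `p_*(j¹_x b) = j¹_x (p ∘ b)`, that is, the differential at `x` of the
local diffeomorphism underlying `b`, as a map `T_x M → TM`. -/
def pStar (j : Jet E x) (V : TangentSpace 𝓘(ℝ, E) x) : T1 E M :=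
  Quotient.lift (s := LocalBisection.jetSetoid E x)
    (fun b => tangentMap 𝓘(ℝ, E) 𝓘(ℝ, E) b.base ⟨x, V⟩)
    (fun _ _ h => LocalBisection.JetRel.tangentMap_base_eq h V) j

/-- The action of a `(1,1)`-jet on the vectors of `T²M` over `x`:
`j¹_x b · (dX_t/dt)|_{t=0} = d(b · X_t)/dt|_{t=0}`. The vector is `ξ ∈ T_{⟨x, u⟩} TM`. -/
def act (j : Jet E x) (u : TangentSpace 𝓘(ℝ, E) x)
    (ξ : TangentSpace 𝓘(ℝ, E).tangent (⟨x, u⟩ : T1 E M)) : T2 E M :=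
  Quotient.lift (s := LocalBisection.jetSetoid E x)
    (fun b => tangentMap 𝓘(ℝ, E).tangent 𝓘(ℝ, E).tangent b.toFun (⟨⟨x, u⟩, ξ⟩ : T2 E M))
    (fun _ _ h => LocalBisection.JetRel.tangentMap_eq h u ξ) j

end Jet

/-- The action on `T²M` of a section of the bundle of `(1,1)`-jets:
`ξ ↦ 𝔰(x) · ξ` for `ξ ∈ T²M` over `x ∈ M`. -/
def sectionAct (s : ∀ x : M, Jet E x) (ξ : T2 E M) : T2 E M :=
  (s ξ.1.1).act ξ.1.2 ξ.2

/-- A symmetry jet: a smooth section `𝔰` of the bundle of `(1,1)`-jets over `M` whose first order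
parts `p ∘ 𝔰` and `p_* ∘ 𝔰` are both `-I`. The value `𝔰(x)` is given in coordinates by its target,
two matrices and a bilinear map, which are the coefficients of its action on `T²M`, so that a section is
smooth exactly when its action on `T²M` is. -/
structure SymmetryJet (E M : Type*) [NormedAddCommGroup E] [NormedSpace ℝ E]
    [TopologicalSpace M] [ChartedSpace E M] [IsManifold 𝓘(ℝ, E) ∞ M] where
  /-- the section -/
  toFun : ∀ x : M, Jet E x
  p_eq : ∀ (x : M) (V : TangentSpace 𝓘(ℝ, E) x), (toFun x).p V = ⟨x, -V⟩
  pStar_eq : ∀ (x : M) (V : TangentSpace 𝓘(ℝ, E) x), (toFun x).pStar V = ⟨x, -V⟩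
  smooth : ContMDiff 𝓘(ℝ, E).tangent.tangent 𝓘(ℝ, E).tangent.tangent ∞ (sectionAct toFun)

namespace SymmetryJet

/-- A local bisection `s_x` near `x` with `j¹_x s_x = 𝔰(x)`. -/
def rep (s : SymmetryJet E M) (x : M) : LocalBisection E x := Quotient.out (s.toFun x)

/-- The connection associated to a symmetry jet: `(∇_X Y)_x = ½ [X, Y + s_x(Y)]_x`, where `s_x` is
a local bisection with `j¹_x s_x = 𝔰(x)`. -/
def nabla (s : SymmetryJet E M) (X Y : ∀ x : M, TangentSpace 𝓘(ℝ, E) x) (x : M) :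
    TangentSpace 𝓘(ℝ, E) x :=
  (1 / 2 : ℝ) • VectorField.mlieBracket 𝓘(ℝ, E) X (Y + (s.rep x).pushforward Y) x

/-- The curvature `R(X, Y) Z = ∇_X ∇_Y Z - ∇_Y ∇_X Z - ∇_{[X, Y]} Z`. -/
def curvature (s : SymmetryJet E M) (X Y Z : ∀ x : M, TangentSpace 𝓘(ℝ, E) x) (x : M) :
    TangentSpace 𝓘(ℝ, E) x :=
  s.nabla X (s.nabla Y Z) x - s.nabla Y (s.nabla X Z) x -
    s.nabla (VectorField.mlieBracket 𝓘(ℝ, E) X Y) Z x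

/-- The action of the 1-jets `j¹_x 𝔰` on `T³M`:
`j¹_x 𝔰 · (dξ_t/dt)|_{t=0} = d(𝔰(x_t) · ξ_t)/dt|_{t=0}`, where `ξ_t` is a path in `T²M` and `x_t` its
projection to `M`. -/
def jetAct (s : SymmetryJet E M) : T3 E M → T3 E M :=
  tangentMap 𝓘(ℝ, E).tangent.tangent 𝓘(ℝ, E).tangent.tangent (sectionAct s.toFun)

/-- The action of `κ(j¹_x 𝔰)` on `T³M`: `κ(j¹_x 𝔰) · ζ = κ(j¹_x 𝔰 · κ(ζ))`, where `κ` is the canonical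
involution of `T³M = T²(TM)`. -/
def kappaJetAct (s : SymmetryJet E M) (ζ : T3 E M) : T3 E M :=
  kappa 𝓘(ℝ, E).tangent (s.jetAct (kappa 𝓘(ℝ, E).tangent ζ))

end SymmetryJet

/-- A vector field, seen as a section `M → TM`. -/
def toSection (Z : ∀ x : M, TangentSpace 𝓘(ℝ, E) x) (x : M) : T1 E M := ⟨x, Z x⟩

/-- The element `Z_** Y_* X_x` of `T³M`. -/
def thirdVector (X Y Z : ∀ x : M, TangentSpace 𝓘(ℝ, E) x) (x : M) : T3 E M :=
  tangentMap 𝓘(ℝ, E).tangent 𝓘(ℝ, E).tangent.tangent (tangentMap 𝓘(ℝ, E) 𝓘(ℝ, E).tangent (toSection Z))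
    (tangentMap 𝓘(ℝ, E) 𝓘(ℝ, E).tangent (toSection Y) (toSection X x))

end SymJet

end

/-! Everything is computed in the chart induced by the preferred chart of `M` at `x`. A `(1,1)`-jet
acts linearly on the fibres of `TM` and covers a local diffeomorphism. When both first order parts
are `-I`, its action on `T²M` is therefore `(z, u, v, w) ↦ (z, -u, -v, -w + Γ_z(v, u))`. Here `Γ_z`
is bilinear, not necessarily symmetric, and smooth in `z` (`exists_christoffel`). All the
information in the symmetry jet sits in `Γ`.

On the connection side, `Y + s_x(Y)` vanishes at `x`, so its bracket with `X` reduces to its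
derivative along `X`, which is `2 DY(X) - Γ(X, Y)`. Hence `∇_X Y = DY(X) - ½ Γ(X, Y)`
(`IsSymbol.vcoord_nabla`). The usual formula `dA + A ∧ A` with `A = -½ Γ` then gives `4 R(X, Y) Z =
2 DΓ(Y)(X, Z) - 2 DΓ(X)(Y, Z) + Γ(X, Γ(Y, Z)) - Γ(Y, Γ(X, Z))` (`IsSymbol.curvature_eq`).

On the jet side, differentiating the action on `T²M` gives the action of `j¹𝔰` on `T³M`
(`IsSymbol.jetAct_point3`). Conjugating by `κ`, which exchanges the coordinates `(v, w)` and `(x',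
u')`, gives that of `κ(j¹𝔰)`. The two composites agree in every coordinate except the last. There
the difference depends only on `u = Z`, `v = Y` and `x' = X`, all second order data of the fields
cancelling, and it is exactly the right-hand side above (`IsSymbol.jetAct_commutator`). Since `Π`
reads off the difference of last coordinates, the theorem follows. -/

namespace SymJet

/-! ### Components of tangent vectors in a fixed chart -/

section general

variable {E : Type*} [NormedAddCommGroup E] [NormedSpace ℝ E]
  {H : Type*} [TopologicalSpace H] (I : ModelWithCorners ℝ E H)
  {N : Type*} [TopologicalSpace N] [ChartedSpace H N]

/-- The coordinates of the vectors of `T_y N` in the preferred chart of `N` at `x`. -/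
noncomputable def vcoord (x y : N) : TangentSpace I y →L[ℝ] E :=
  mfderiv I 𝓘(ℝ, E) (extChartAt I x) y

variable [IsManifold I 1 N]

/-- A vector of `T_x N` is stored through its components in the preferred chart at `x`, so that
chart has the identity as derivative at its own centre. This lets raw entries be read as induced
coordinates. -/
theorem vcoord_self (x : N) (v : TangentSpace I x) : vcoord I x x v = v := by
  have h := mfderiv_extChartAt_self (I := I) (x := x)
  exact DFunLike.congr_fun h v

theorem mem_source_tangent {p q : TangentBundle I N} :
    q ∈ (chartAt (ModelProd H E) p).source ↔ q.1 ∈ (chartAt H p.1).source :=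
  TangentBundle.mem_chart_source_iff (I := I) q p

theorem extChartAt_tangent_apply {p q : TangentBundle I N} (h : q.1 ∈ (chartAt H p.1).source) :
    extChartAt I.tangent p q = (extChartAt I p.1 q.1, vcoord I p.1 q.1 q.2) := by
  rw [FiberBundle.extChartAt]
  refine Prod.ext rfl ?_
  have h1 := TangentBundle.continuousLinearMapAt_trivializationAt (I := I) h
  refine Eq.trans ?_ (DFunLike.congr_fun h1 q.2)
  rw [Trivialization.continuousLinearMapAt_apply, Trivialization.coe_linearMapAt_of_mem]
  · rfl
  · exact h

theorem extChartAt_tangent_self (p : TangentBundle I N) :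
    extChartAt I.tangent p p = (extChartAt I p.1 p.1, (show E from p.2)) := by
  rw [extChartAt_tangent_apply I (mem_chart_source H p.1), vcoord_self]

/-- Chain rule: the components of a differential are obtained by differentiating `f` followed by a
fixed chart, so no moving chart has to be differentiated. -/
theorem vcoord_tangentMap {E' : Type*} [NormedAddCommGroup E'] [NormedSpace ℝ E']
    {H' : Type*} [TopologicalSpace H'] {I' : ModelWithCorners ℝ E' H'}
    {N' : Type*} [TopologicalSpace N'] [ChartedSpace H' N'] [IsManifold I' 1 N']
    {f : N' → N} {y : N'} (hf : MDifferentiableAt I' I f y) {x : N}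
    (h : f y ∈ (chartAt H x).source) (v : TangentSpace I' y) :
    vcoord I x (f y) (mfderiv I' I f y v) =
      mfderiv I' 𝓘(ℝ, E) (fun z => extChartAt I x (f z)) y v := by
  have := mfderiv_comp y (mdifferentiableAt_extChartAt (I := I) h) hf
  exact (DFunLike.congr_fun this v).symm

end general

/-! ### Vertical lifts and the projection of a tangent bundle, in coordinates -/

section tangent

variable {E : Type*} [NormedAddCommGroup E] [NormedSpace ℝ E]
  {H : Type*} [TopologicalSpace H] (I : ModelWithCorners ℝ E H)
  {N : Type*} [TopologicalSpace N] [ChartedSpace H N] [IsManifold I ∞ N]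

theorem mdifferentiableAt_line (y : N) (u V : TangentSpace I y) (t : ℝ) :
    MDifferentiableAt 𝓘(ℝ, ℝ) I.tangent
      (fun t : ℝ => (⟨y, u + t • V⟩ : TangentBundle I N)) t := by
  rw [mdifferentiableAt_totalSpace]
  refine ⟨mdifferentiableAt_const, ?_⟩
  have h : ∀ r : ℝ, ((trivializationAt E (TangentSpace I) y)
      (⟨y, u + r • V⟩ : TangentBundle I N)).2 = (show E from u) + r • (show E from V) := by
    intro r
    have := congrArg Prod.snd (extChartAt_tangent_self I (⟨y, u + r • V⟩ : TangentBundle I N))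
    rw [FiberBundle.extChartAt] at this
    exact this
  have h' : DifferentiableAt ℝ (fun r : ℝ => (show E from u) + r • (show E from V)) t := by
    fun_prop
  refine MDifferentiableAt.congr_of_eventuallyEq (h'.mdifferentiableAt)
    (Filter.Eventually.of_forall h)

/-- In an induced chart the curve `u + t V` is an affine line in the fibre direction. -/
theorem vcoord_vlift {p u : TangentBundle I N} (h : u.1 ∈ (chartAt H p.1).source)
    (V : TangentSpace I u.1) :
    vcoord I.tangent p u (vlift I u V) = ((0, vcoord I p.1 u.1 V) : E × E) := by
  have h0 : (⟨u.1, u.2 + (0 : ℝ) • V⟩ : TangentBundle I N) = u := by simp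
  have hd := mdifferentiableAt_line I u.1 u.2 V 0
  have h1 := vcoord_tangentMap I.tangent (x := p) hd
    (by rw [h0]; exact (mem_source_tangent I).2 h) (1 : ℝ)
  rw [h0] at h1
  refine h1.trans ?_
  have h2 : (fun t : ℝ => extChartAt I.tangent p (⟨u.1, u.2 + t • V⟩ : TangentBundle I N)) =
      fun t : ℝ => ((extChartAt I p.1 u.1, vcoord I p.1 u.1 u.2 + t • vcoord I p.1 u.1 V) :
        E × E) := by
    funext t
    have h3 := extChartAt_tangent_apply I (p := p) (q := ⟨u.1, u.2 + t • V⟩) h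
    rw [h3, map_add, map_smul]
  rw [h2, mfderiv_eq_fderiv]
  have h3 : HasDerivAt (fun t : ℝ => ((extChartAt I p.1 u.1,
      vcoord I p.1 u.1 u.2 + t • vcoord I p.1 u.1 V) : E × E)) (0, vcoord I p.1 u.1 V) 0 := by
    refine (hasDerivAt_const _ _).prodMk ?_
    simpa using ((hasDerivAt_id (0 : ℝ)).smul_const (vcoord I p.1 u.1 V)).const_add
      (vcoord I p.1 u.1 u.2)
  exact h3.deriv

theorem vcoord_fst {p q : TangentBundle I N} (h : q.1 ∈ (chartAt H p.1).source)
    (ξ : TangentSpace I.tangent q) :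
    Prod.fst (α := E) (β := E) (vcoord I.tangent p q ξ) =
      vcoord I p.1 q.1 (mfderiv I.tangent I (fun v : TangentBundle I N => v.1) q ξ) := by
  have hd : MDifferentiableAt I.tangent I (fun v : TangentBundle I N => v.1) q :=
    (Bundle.contMDiffAt_proj (n := 1) (TangentSpace I)).mdifferentiableAt (by simp)
  rw [vcoord_tangentMap I hd h ξ]
  have h2 := mdifferentiableAt_extChartAt (I := I.tangent) ((mem_source_tangent I (p := p)).2 h)
  have h3 : (fun v : TangentBundle I N => extChartAt I p.1 v.1) =ᶠ[𝓝 q]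
      fun v => (ContinuousLinearMap.fst ℝ E E) (extChartAt I.tangent p v) := by
    filter_upwards [(chartAt (ModelProd H E) p).open_source.mem_nhds
      ((mem_source_tangent I (p := p)).2 h)] with v hv
    rw [extChartAt_tangent_apply I ((mem_source_tangent I).1 hv)]
    rfl
  rw [h3.mfderiv_eq]
  have h4 := mfderiv_comp q (ContinuousLinearMap.fst ℝ E E).mdifferentiableAt h2
  rw [ContinuousLinearMap.mfderiv_eq] at h4
  exact (DFunLike.congr_fun h4 ξ).symm

theorem mfderiv_proj_apply (q : TangentBundle I N) (ξ : TangentSpace I.tangent q) :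
    mfderiv I.tangent I (fun v : TangentBundle I N => v.1) q ξ =
      Prod.fst (α := E) (β := E) ξ := by
  have := vcoord_fst I (mem_chart_source H q.1) ξ
  rw [vcoord_self I.tangent, vcoord_self] at this
  exact this.symm

theorem vlift_eq (u : TangentBundle I N) (V : TangentSpace I u.1) :
    vlift I u V = ((0, V) : E × E) := by
  have := vcoord_vlift I (mem_chart_source H u.1) V
  rwa [vcoord_self I.tangent, vcoord_self] at this

end tangent

/-! ### Derivatives of fibrewise linear maps -/

section fibrewise

variable {E : Type*} [NormedAddCommGroup E] [NormedSpace ℝ E] [FiniteDimensional ℝ E]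

/-- The derivative of a map that is linear on the fibres of `E × E → E`, at the points of a fibre
on which it is `-1`. -/
theorem exists_clm_fderiv_fibrewise_linear {F : E × E → E} {z : E}
    (hlin : ∀ᶠ z' in 𝓝 z, IsLinearMap ℝ fun u => F (z', u))
    (hd : ∀ u, DifferentiableAt ℝ F (z, u)) (h0 : ∀ u, F (z, u) = -u) :
    ∃ Γ : E →L[ℝ] E →L[ℝ] E, ∀ u v w, fderiv ℝ F (z, u) (v, w) = -w + Γ v u := by
  have hz : ∀ u, HasFDerivAt (fun z' => F (z', u))
      ((fderiv ℝ F (z, u)).comp (ContinuousLinearMap.inl ℝ E E)) z := fun u =>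
    HasFDerivAt.comp (g := F) z (hd u).hasFDerivAt (hasFDerivAt_prodMk_left z u)
  -- Linearity in `u` holds for all base points near `z`, so it survives differentiation in the base
  -- direction, by uniqueness of derivatives.
  have hadd : ∀ u u' v, fderiv ℝ F (z, u + u') (v, 0) =
      fderiv ℝ F (z, u) (v, 0) + fderiv ℝ F (z, u') (v, 0) := by
    intro u u' v
    have h1 := ((hz u).add (hz u')).congr_of_eventuallyEq (f₁ := fun z' => F (z', u + u'))
      (by filter_upwards [hlin] with z' h using h.map_add u u')
    exact DFunLike.congr_fun ((hz (u + u')).unique h1) v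
  have hsmul : ∀ (c : ℝ) u v, fderiv ℝ F (z, c • u) (v, 0) = c • fderiv ℝ F (z, u) (v, 0) := by
    intro c u v
    have h1 := ((hz u).const_smul c).congr_of_eventuallyEq (f₁ := fun z' => F (z', c • u))
      (by filter_upwards [hlin] with z' h using h.map_smul c u)
    exact DFunLike.congr_fun ((hz (c • u)).unique h1) v
  let Γ : E →ₗ[ℝ] E →ₗ[ℝ] E := LinearMap.mk₂ ℝ (fun v u => fderiv ℝ F (z, u) (v, 0))
    (fun v v' u => by rw [← map_add, Prod.mk_add_mk, add_zero])
    (fun c v u => by rw [← map_smul, Prod.smul_mk, smul_zero])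
    (fun v u u' => hadd u u' v) (fun c v u => hsmul c u v)
  -- Finite dimension makes the algebraic bilinear map continuous in both arguments.
  refine ⟨LinearMap.toContinuousLinearMap
    ((LinearMap.toContinuousLinearMap (𝕜 := ℝ) (E := E) (F' := E)).toLinearMap ∘ₗ Γ),
    fun u v w => ?_⟩
  have hw : fderiv ℝ F (z, u) (0, w) = -w := by
    have h1 := HasFDerivAt.comp (g := F) u (hd u).hasFDerivAt (hasFDerivAt_prodMk_right z u)
    have h2 : HasFDerivAt (F ∘ fun u' => (z, u')) (-ContinuousLinearMap.id ℝ E) u := by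
      have : (F ∘ fun u' => (z, u')) = fun u' => -u' := funext h0
      rw [this]
      exact (hasFDerivAt_id u).neg
    exact DFunLike.congr_fun (h1.unique h2) w
  have hs : ((v, w) : E × E) = (0, w) + (v, 0) := by simp
  rw [hs, map_add, hw]
  rfl

end fibrewise

/-! ### Curvature of a connection on a vector space -/

section flat

variable {E : Type*} [NormedAddCommGroup E] [NormedSpace ℝ E]

/-- The connection with Christoffel symbols `-½ Γ` on a vector space. -/
noncomputable def flatNabla (Γ : E → E →L[ℝ] E →L[ℝ] E) (X Y : E → E) (z : E) : E :=
  fderiv ℝ Y z (X z) - (1 / 2 : ℝ) • Γ z (X z) (Y z)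

theorem flatNabla_apply (Γ : E → E →L[ℝ] E →L[ℝ] E) (X Y : E → E) (z : E) :
    flatNabla Γ X Y z = fderiv ℝ Y z (X z) - (1 / 2 : ℝ) • Γ z (X z) (Y z) := rfl

theorem hasFDerivAt_flatNabla {Γ : E → E →L[ℝ] E →L[ℝ] E} {Y Z : E → E} {z : E}
    (hΓ : DifferentiableAt ℝ Γ z) (hY : DifferentiableAt ℝ Y z) (hZ : ContDiffAt ℝ ∞ Z z) :
    ∃ L : E →L[ℝ] E, HasFDerivAt (flatNabla Γ Y Z) L z ∧ ∀ v, L v =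
      fderiv ℝ (fderiv ℝ Z) z v (Y z) + fderiv ℝ Z z (fderiv ℝ Y z v) -
        (1 / 2 : ℝ) • (fderiv ℝ Γ z v (Y z) (Z z) + Γ z (fderiv ℝ Y z v) (Z z) +
          Γ z (Y z) (fderiv ℝ Z z v)) := by
  have hZ' : DifferentiableAt ℝ (fderiv ℝ Z) z :=
    (hZ.fderiv_right (m := 1) (by exact WithTop.coe_le_coe.2 le_top)).differentiableAt (by simp)
  have hZ1 : DifferentiableAt ℝ Z z := hZ.differentiableAt (by simp)
  refine ⟨_, (hZ'.hasFDerivAt.clm_apply hY.hasFDerivAt).sub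
    (((hΓ.hasFDerivAt.clm_apply hY.hasFDerivAt).clm_apply hZ1.hasFDerivAt).const_smul (1 / 2 : ℝ)),
    fun v => ?_⟩
  simp
  module

/-- This is `dA + A ∧ A` for `A = -½ Γ`. The parenthesis subtracted on the left is the covariant
derivative of `Z` along `[X, Y]`; the terms in `DX`, `DY` and `DZ` cancel without symmetry of `Γ`.
-/
theorem flatNabla_curvature {Γ : E → E →L[ℝ] E →L[ℝ] E} {X Y Z : E → E} {z : E}
    (hΓ : DifferentiableAt ℝ Γ z) (hX : DifferentiableAt ℝ X z) (hY : DifferentiableAt ℝ Y z)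
    (hZ : ContDiffAt ℝ ∞ Z z) :
    flatNabla Γ X (flatNabla Γ Y Z) z - flatNabla Γ Y (flatNabla Γ X Z) z -
      (fderiv ℝ Z z (fderiv ℝ Y z (X z) - fderiv ℝ X z (Y z)) -
        (1 / 2 : ℝ) • Γ z (fderiv ℝ Y z (X z) - fderiv ℝ X z (Y z)) (Z z)) =
    (1 / 4 : ℝ) • ((2 : ℝ) • fderiv ℝ Γ z (Y z) (X z) (Z z) -
      (2 : ℝ) • fderiv ℝ Γ z (X z) (Y z) (Z z) + Γ z (X z) (Γ z (Y z) (Z z)) -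
        Γ z (Y z) (Γ z (X z) (Z z))) := by
  obtain ⟨L₁, h₁, e₁⟩ := hasFDerivAt_flatNabla hΓ hY hZ
  obtain ⟨L₂, h₂, e₂⟩ := hasFDerivAt_flatNabla hΓ hX hZ
  -- Symmetry of second derivatives removes the Hessian of `Z`.
  have hs : fderiv ℝ (fderiv ℝ Z) z (X z) (Y z) = fderiv ℝ (fderiv ℝ Z) z (Y z) (X z) :=
    (hZ.isSymmSndFDerivAt (by
      rw [minSmoothness_of_isRCLikeNormedField]
      exact WithTop.coe_le_coe.2 le_top)).eq _ _
  simp only [flatNabla_apply, h₁.fderiv, h₂.fderiv, e₁, e₂, hs, map_sub, map_smul, sub_apply]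
  module

end flat

/-! ### The charts of `TM` and `T²M` induced by one chart of `M` -/

variable {E : Type*} [NormedAddCommGroup E] [NormedSpace ℝ E]
  {M : Type*} [TopologicalSpace M] [ChartedSpace E M] [IsManifold 𝓘(ℝ, E) ∞ M]

theorem mdifferentiableAt_extChartAt_symm' {E' H' N : Type*} [NormedAddCommGroup E']
    [NormedSpace ℝ E'] [TopologicalSpace H'] (I : ModelWithCorners ℝ E' H') [I.Boundaryless]
    [TopologicalSpace N] [ChartedSpace H' N] [IsManifold I 1 N] {p : N} {e : E'}
    (he : e ∈ (extChartAt I p).target) :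
    MDifferentiableAt 𝓘(ℝ, E') I (extChartAt I p).symm e := by
  have := mdifferentiableWithinAt_extChartAt_symm he
  rwa [I.range_eq_univ, mdifferentiableWithinAt_univ] at this

/-- The chart of `TM` induced by the preferred chart of `M` at `x`. -/
noncomputable abbrev chartTM (x : M) : PartialEquiv (T1 E M) (E × E) :=
  extChartAt 𝓘(ℝ, E).tangent (⟨x, 0⟩ : T1 E M)

/-- The chart of `T²M` induced by the preferred chart of `M` at `x`. -/
noncomputable abbrev chartT2M (x : M) : PartialEquiv (T2 E M) ((E × E) × (E × E)) :=
  extChartAt 𝓘(ℝ, E).tangent.tangent (⟨⟨x, 0⟩, 0⟩ : T2 E M)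

theorem chartTM_apply {x : M} {p : T1 E M} (h : p.1 ∈ (chartAt E x).source) :
    chartTM x p = (extChartAt 𝓘(ℝ, E) x p.1, vcoord 𝓘(ℝ, E) x p.1 p.2) :=
  extChartAt_tangent_apply 𝓘(ℝ, E) (p := (⟨x, 0⟩ : T1 E M)) h

theorem chartT2M_apply {x : M} {ξ : T2 E M} (h : ξ.1.1 ∈ (chartAt E x).source) :
    chartT2M x ξ = (chartTM x ξ.1, vcoord 𝓘(ℝ, E).tangent (⟨x, 0⟩ : T1 E M) ξ.1 ξ.2) :=
  extChartAt_tangent_apply 𝓘(ℝ, E).tangent (p := (⟨⟨x, 0⟩, 0⟩ : T2 E M))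
    ((mem_source_tangent 𝓘(ℝ, E) (p := (⟨x, 0⟩ : T1 E M))).2 h)

theorem chartTM_symm_apply {x : M} {q : E × E} (h : q.1 ∈ (extChartAt 𝓘(ℝ, E) x).target) :
    (chartTM x).symm q = ⟨(extChartAt 𝓘(ℝ, E) x).symm q.1,
      (trivializationAt E (TangentSpace 𝓘(ℝ, E)) x).symmL ℝ
            ((extChartAt 𝓘(ℝ, E) x).symm q.1) q.2⟩ := by
  have hm : (extChartAt 𝓘(ℝ, E) x).symm q.1 ∈ (chartAt E x).source := by
    simpa using (extChartAt 𝓘(ℝ, E) x).map_target h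
  rw [chartTM, FiberBundle.extChartAt, Trivialization.symmL_apply _ hm]
  exact ((trivializationAt E (TangentSpace 𝓘(ℝ, E)) x).mk_symm hm q.2).symm

/-! ### The bilinear symbol of a symmetry jet -/

namespace LocalBisection

/-- The `v` entry is governed by the differential of the underlying diffeomorphism, and the `w`
entry by differentiating a fibrewise linear map. The chart stays centred at `x` while `y` varies, so
that the resulting `Γ` can later be differentiated in `y`. -/
theorem chartT2M_tangentMap_toFun [FiniteDimensional ℝ E] {x y : M}
    (hy : y ∈ (chartAt E x).source) (b : LocalBisection E y)
    (hp : ∀ u : TangentSpace 𝓘(ℝ, E) y, b.toFun ⟨y, u⟩ = ⟨y, -u⟩)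
    (hps : ∀ V : TangentSpace 𝓘(ℝ, E) y,
      tangentMap 𝓘(ℝ, E) 𝓘(ℝ, E) b.base ⟨y, V⟩ = ⟨y, -V⟩) :
    ∃ Γ : E →L[ℝ] E →L[ℝ] E, ∀ (u : TangentSpace 𝓘(ℝ, E) y)
      (ξ : TangentSpace 𝓘(ℝ, E).tangent (⟨y, u⟩ : T1 E M)) (v w : E),
      vcoord 𝓘(ℝ, E).tangent (⟨x, 0⟩ : T1 E M) ⟨y, u⟩ ξ = ((v, w) : E × E) →
      chartT2M x (tangentMap 𝓘(ℝ, E).tangent 𝓘(ℝ, E).tangent b.toFun ⟨⟨y, u⟩, ξ⟩) =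
      ((extChartAt 𝓘(ℝ, E) x y, -vcoord 𝓘(ℝ, E) x y u),
        (-v, -w + Γ v (vcoord 𝓘(ℝ, E) x y u))) := by
  have hby : b.base y = y := congrArg (fun v : T1 E M => v.1) (hp 0)
  have hsrc : ∀ u : TangentSpace 𝓘(ℝ, E) y,
      (⟨y, u⟩ : T1 E M) ∈ (chartAt (ModelProd E E) (⟨x, 0⟩ : T1 E M)).source := fun u =>
    (mem_source_tangent 𝓘(ℝ, E) (p := (⟨x, 0⟩ : T1 E M))).2 hy
  have hfsrc : ∀ u : TangentSpace 𝓘(ℝ, E) y,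
      b.toFun ⟨y, u⟩ ∈ (chartAt (ModelProd E E) (⟨x, 0⟩ : T1 E M)).source := fun u => by
    rw [hp]; exact hsrc _
  have hval : ∀ u : TangentSpace 𝓘(ℝ, E) y, chartTM x (b.toFun ⟨y, u⟩) =
      (extChartAt 𝓘(ℝ, E) x y, -vcoord 𝓘(ℝ, E) x y u) := fun u => by
    rw [hp, chartTM_apply hy, map_neg]
  have hd1 : ∀ u : TangentSpace 𝓘(ℝ, E) y,
      MDifferentiableAt 𝓘(ℝ, E).tangent 𝓘(ℝ, E × E) (fun p => chartTM x (b.toFun p))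
        (⟨y, u⟩ : T1 E M) := fun u =>
    (mdifferentiableAt_extChartAt (hfsrc u)).comp (⟨y, u⟩ : T1 E M) (b.mdifferentiableAt_toFun u)
  set F : E × E → E × E := fun q => chartTM x (b.toFun ((chartTM x).symm q)) with hF
  have hc : ∀ u : TangentSpace 𝓘(ℝ, E) y, chartTM x (⟨y, u⟩ : T1 E M) =
      (extChartAt 𝓘(ℝ, E) x y, vcoord 𝓘(ℝ, E) x y u) := fun u => chartTM_apply hy
  have hdF : ∀ u : TangentSpace 𝓘(ℝ, E) y,
      DifferentiableAt ℝ F (extChartAt 𝓘(ℝ, E) x y, vcoord 𝓘(ℝ, E) x y u) := by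
    intro u
    rw [← hc u, ← mdifferentiableAt_iff_differentiableAt]
    have hs : (chartTM x).symm (chartTM x (⟨y, u⟩ : T1 E M)) = ⟨y, u⟩ :=
      (chartTM x).left_inv (by rw [extChartAt_source]; exact hsrc u)
    have h1 := mdifferentiableAt_extChartAt_symm' 𝓘(ℝ, E).tangent
      (p := (⟨x, 0⟩ : T1 E M)) (e := chartTM x (⟨y, u⟩ : T1 E M))
      ((chartTM x).map_source (by rw [extChartAt_source]; exact hsrc u))
    have h2 := hd1 u
    rw [← hs] at h2
    exact MDifferentiableAt.comp (g := fun p => chartTM x (b.toFun p)) _ h2 h1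
  have hsurj : ∀ u : E, ∃ u' : TangentSpace 𝓘(ℝ, E) y, vcoord 𝓘(ℝ, E) x y u' = u := by
    intro u
    have := (isInvertible_mfderiv_extChartAt (I := 𝓘(ℝ, E)) (x := x) (y := y)
      (by rwa [extChartAt_source])).bijective.2 u
    exact this
  -- Near `y` the bisection lands in the domain of the chart at `x`, where its fibre part is a
  -- composite of linear maps.
  have hlin : ∀ᶠ z in 𝓝 (extChartAt 𝓘(ℝ, E) x y), IsLinearMap ℝ fun u => (F (z, u)).2 := by
    have hcs := continuousAt_extChartAt_symm' (I := 𝓘(ℝ, E)) (x := x) (x' := y)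
      (by rwa [extChartAt_source])
    have hx : (extChartAt 𝓘(ℝ, E) x).symm (extChartAt 𝓘(ℝ, E) x y) = y :=
      (extChartAt 𝓘(ℝ, E) x).left_inv (by rwa [extChartAt_source])
    have e1 := (isOpen_extChartAt_target (I := 𝓘(ℝ, E)) x).mem_nhds
      ((extChartAt 𝓘(ℝ, E) x).map_source (x := y) (by rwa [extChartAt_source]))
    have e3 := hcs.preimage_mem_nhds
      (t := b.base.source ∩ b.base ⁻¹' (chartAt E x).source) (by
        rw [hx]
        exact (b.base.continuousOn.isOpen_inter_preimage b.base.open_source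
          (chartAt E x).open_source).mem_nhds ⟨b.mem_source, by rw [mem_preimage, hby]; exact hy⟩)
    filter_upwards [e1, e3] with z h1 h3
    have e4 : ∀ u, (F (z, u)).2 = vcoord 𝓘(ℝ, E) x (b.base ((extChartAt 𝓘(ℝ, E) x).symm z))
        (b.lin ((extChartAt 𝓘(ℝ, E) x).symm z)
          ((trivializationAt E (TangentSpace 𝓘(ℝ, E)) x).symmL ℝ
            ((extChartAt 𝓘(ℝ, E) x).symm z) u)) := by
      intro u
      rw [hF]
      dsimp only
      rw [chartTM_symm_apply h1]
      exact congrArg Prod.snd (chartTM_apply (x := x) (p := b.toFun ⟨_, _⟩) h3.2)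
    constructor
    · intro u u'
      simp only [e4, map_add]
    · intro c u
      simp only [e4, map_smul]
  have hd2 : ∀ u, DifferentiableAt ℝ (fun q => (F q).2) (extChartAt 𝓘(ℝ, E) x y, u) := by
    intro u
    obtain ⟨u', rfl⟩ := hsurj u
    exact (hdF u').snd
  have h0 : ∀ u, (F (extChartAt 𝓘(ℝ, E) x y, u)).2 = -u := by
    intro u
    obtain ⟨u', rfl⟩ := hsurj u
    rw [hF]
    dsimp only
    rw [← hc u', (chartTM x).left_inv (by rw [extChartAt_source]; exact hsrc u'), hval]
  obtain ⟨Γ, hΓ⟩ := exists_clm_fderiv_fibrewise_linear hlin hd2 h0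
  refine ⟨Γ, fun u ξ v w h => ?_⟩
  have hb1 : (b.toFun ⟨y, u⟩).1 ∈ (chartAt E x).source := by rw [hp]; exact hy
  have e1 := chartT2M_apply (x := x)
    (ξ := tangentMap 𝓘(ℝ, E).tangent 𝓘(ℝ, E).tangent b.toFun ⟨⟨y, u⟩, ξ⟩) hb1
  rw [e1]
  refine Prod.ext (hval u) (Prod.ext ?_ ?_)
  -- Horizontal part: projecting to `M` after `b` equals `b.base` after projecting, and the
  -- differential of `b.base` is `-I`.
  · refine (vcoord_fst 𝓘(ℝ, E) (p := (⟨x, 0⟩ : T1 E M)) (q := b.toFun ⟨y, u⟩) hb1 _).trans ?_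
    have hv := vcoord_fst 𝓘(ℝ, E) (p := (⟨x, 0⟩ : T1 E M)) (q := ⟨y, u⟩) hy ξ
    rw [h] at hv
    have hproj : ∀ q : T1 E M, MDifferentiableAt 𝓘(ℝ, E).tangent 𝓘(ℝ, E)
        (fun v : T1 E M => v.1) q := fun q =>
      (Bundle.contMDiffAt_proj (n := 1) (TangentSpace 𝓘(ℝ, E))).mdifferentiableAt (by simp)
    have hbase : MDifferentiableAt 𝓘(ℝ, E) 𝓘(ℝ, E) b.base y :=
      (b.contMDiffOn_base.contMDiffAt
        (b.base.open_source.mem_nhds b.mem_source)).mdifferentiableAt (by simp)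
    have c1 := mfderiv_comp (⟨y, u⟩ : T1 E M) (hproj (b.toFun ⟨y, u⟩))
      (b.mdifferentiableAt_toFun u)
    have c2 := mfderiv_comp (g := b.base) (f := fun v : T1 E M => v.1) (⟨y, u⟩ : T1 E M)
      hbase (hproj ⟨y, u⟩)
    have c3 := DFunLike.congr_fun (c1.symm.trans c2) ξ
    refine (congrArg (vcoord 𝓘(ℝ, E) x (b.base y)) c3).trans ?_
    have c4 : ∀ V : TangentSpace 𝓘(ℝ, E) y,
        vcoord 𝓘(ℝ, E) x (b.base y) (mfderiv 𝓘(ℝ, E) 𝓘(ℝ, E) b.base y V) =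
          -vcoord 𝓘(ℝ, E) x y V := fun V =>
      (congrArg Prod.snd (chartTM_apply (x := x)
        (p := tangentMap 𝓘(ℝ, E) 𝓘(ℝ, E) b.base ⟨y, V⟩) hb1)).symm.trans
      ((congrArg (fun p => (chartTM x p).2) (hps V)).trans
      ((congrArg Prod.snd (chartTM_apply (x := x) (p := ⟨y, -V⟩) hy)).trans (map_neg _ _)))
    exact (c4 _).trans (congrArg Neg.neg hv.symm)
  · have e2 := vcoord_tangentMap 𝓘(ℝ, E).tangent (x := (⟨x, 0⟩ : T1 E M))
      (b.mdifferentiableAt_toFun u) (hfsrc u) ξ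
    refine (congrArg Prod.snd e2).trans ?_
    have e3 : (fun p => chartTM x (b.toFun p)) =ᶠ[𝓝 (⟨y, u⟩ : T1 E M)]
        fun p => F (chartTM x p) := by
      filter_upwards [(chartAt (ModelProd E E) (⟨x, 0⟩ : T1 E M)).open_source.mem_nhds
        (hsrc u)] with p hpp
      rw [hF]
      dsimp only
      rw [(chartTM x).left_inv (by rwa [extChartAt_source])]
    rw [e3.mfderiv_eq]
    have e4 := mfderiv_comp (g := F) (⟨y, u⟩ : T1 E M)
      (by rw [hc u]; exact (hdF u).mdifferentiableAt) (mdifferentiableAt_extChartAt (hsrc u))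
    refine (congrArg Prod.snd (DFunLike.congr_fun e4 ξ)).trans ?_
    rw [mfderiv_eq_fderiv]
    have e5 := hΓ (vcoord 𝓘(ℝ, E) x y u) v w
    rw [(hdF u).hasFDerivAt.snd.fderiv] at e5
    refine Eq.trans ?_ e5
    rw [← hc u, ← h]
    rfl

end LocalBisection

theorem mem_chartT2M_source {x : M} {ξ : T2 E M} :
    ξ ∈ (chartT2M x).source ↔ ξ.1.1 ∈ (chartAt E x).source := by
  rw [extChartAt_source]
  exact (mem_source_tangent 𝓘(ℝ, E).tangent (p := (⟨⟨x, 0⟩, 0⟩ : T2 E M))).trans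
    (mem_source_tangent 𝓘(ℝ, E) (p := (⟨x, 0⟩ : T1 E M)))

theorem mem_extChartAt_tangent_target {E H N : Type*} [NormedAddCommGroup E] [NormedSpace ℝ E]
    [TopologicalSpace H] (I : ModelWithCorners ℝ E H) [TopologicalSpace N] [ChartedSpace H N]
    [IsManifold I 1 N] {p : TangentBundle I N} {q : E × E} :
    q ∈ (extChartAt I.tangent p).target ↔ q.1 ∈ (extChartAt I p.1).target := by
  rw [FiberBundle.extChartAt_target]
  constructor
  · exact fun h => h.1.1
  · intro h
    refine ⟨⟨h, ?_⟩, mem_univ _⟩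
    have := (extChartAt I p.1).map_target h
    rwa [extChartAt_source] at this

theorem mem_chartTM_target {x : M} {q : E × E} :
    q ∈ (chartTM x).target ↔ q.1 ∈ (extChartAt 𝓘(ℝ, E) x).target :=
  mem_extChartAt_tangent_target 𝓘(ℝ, E) (p := (⟨x, 0⟩ : T1 E M))

theorem mem_chartT2M_target {x : M} {q : (E × E) × (E × E)} :
    q ∈ (chartT2M x).target ↔ q.1.1 ∈ (extChartAt 𝓘(ℝ, E) x).target :=
  (mem_extChartAt_tangent_target 𝓘(ℝ, E).tangent (p := (⟨⟨x, 0⟩, 0⟩ : T2 E M))).trans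
    mem_chartTM_target

namespace SymmetryJet

variable (s : SymmetryJet E M)

theorem rep_toFun (y : M) (u : TangentSpace 𝓘(ℝ, E) y) :
    (s.rep y).toFun ⟨y, u⟩ = ⟨y, -u⟩ := by
  have h := s.p_eq y u
  rw [← Quotient.out_eq (s.toFun y)] at h
  exact h

theorem tangentMap_rep_base (y : M) (V : TangentSpace 𝓘(ℝ, E) y) :
    tangentMap 𝓘(ℝ, E) 𝓘(ℝ, E) (s.rep y).base ⟨y, V⟩ = ⟨y, -V⟩ := by
  have h := s.pStar_eq y V
  rw [← Quotient.out_eq (s.toFun y)] at h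
  exact h

theorem sectionAct_eq (ξ : T2 E M) :
    sectionAct s.toFun ξ =
      tangentMap 𝓘(ℝ, E).tangent 𝓘(ℝ, E).tangent (s.rep ξ.1.1).toFun ξ := by
  have h := Quotient.out_eq (s.toFun ξ.1.1)
  change (s.toFun ξ.1.1).act ξ.1.2 ξ.2 = _
  rw [← h]
  rfl

theorem sectionAct_base (ξ : T2 E M) : (sectionAct s.toFun ξ).1 = ⟨ξ.1.1, -ξ.1.2⟩ := by
  rw [sectionAct_eq]
  exact s.rep_toFun ξ.1.1 ξ.1.2

/-- In coordinates, a symmetry jet acts on `T²M` by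
`(z, u, v, w) ↦ (z, -u, -v, -w + Γ z v u)`, with `Γ` smooth and bilinear in `v`, `u`. -/
theorem exists_christoffel [FiniteDimensional ℝ E] (x : M) :
    ∃ Γ : E → E →L[ℝ] E →L[ℝ] E, ContDiffOn ℝ ∞ Γ (extChartAt 𝓘(ℝ, E) x).target ∧
      ∀ (ξ : T2 E M), ξ.1.1 ∈ (chartAt E x).source → ∀ z u v w : E,
        chartT2M x ξ = ((z, u), (v, w)) →
        chartT2M x (sectionAct s.toFun ξ) = ((z, -u), (-v, -w + Γ z v u)) := by
  -- The membership condition stands inside the existential so that `choose` yields `Γ` on all of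
  -- `E`; the witness outside the chart target is irrelevant and taken to be `0`.
  have h1 : ∀ z : E, ∃ G : E →L[ℝ] E →L[ℝ] E, z ∈ (extChartAt 𝓘(ℝ, E) x).target →
      ∀ (ξ : T2 E M), ξ.1.1 = (extChartAt 𝓘(ℝ, E) x).symm z → ∀ z' u v w : E,
        chartT2M x ξ = ((z', u), (v, w)) →
        chartT2M x (sectionAct s.toFun ξ) = ((z, -u), (-v, -w + G v u)) := by
    intro z
    by_cases hz : z ∈ (extChartAt 𝓘(ℝ, E) x).target
    · have hm : (extChartAt 𝓘(ℝ, E) x).symm z ∈ (chartAt E x).source := by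
        simpa using (extChartAt 𝓘(ℝ, E) x).map_target hz
      obtain ⟨G, hG⟩ := (s.rep ((extChartAt 𝓘(ℝ, E) x).symm z)).chartT2M_tangentMap_toFun hm
        (s.rep_toFun _) (s.tangentMap_rep_base _)
      refine ⟨G, fun _ ξ hξ z' u v w h => ?_⟩
      have hz' := (extChartAt 𝓘(ℝ, E) x).right_inv hz
      generalize (extChartAt 𝓘(ℝ, E) x).symm z = y at *
      obtain ⟨⟨y', u'⟩, ξ'⟩ := ξ
      obtain rfl : y' = y := hξ
      rw [chartT2M_apply hm, chartTM_apply hm] at h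
      have e1 := hG u' ξ' v w (congrArg Prod.snd h)
      have e2 : vcoord 𝓘(ℝ, E) x y' u' = u := congrArg (fun q => q.1.2) h
      rw [sectionAct_eq]
      refine e1.trans ?_
      rw [e2, hz']
    · exact ⟨0, fun h => absurd h hz⟩
  choose Γ hΓ using h1
  have h2 : ∀ (ξ : T2 E M), ξ.1.1 ∈ (chartAt E x).source → ∀ z u v w : E,
        chartT2M x ξ = ((z, u), (v, w)) →
        chartT2M x (sectionAct s.toFun ξ) = ((z, -u), (-v, -w + Γ z v u)) := by
    intro ξ hξ z u v w h
    have e : z = extChartAt 𝓘(ℝ, E) x ξ.1.1 := by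
      rw [chartT2M_apply hξ, chartTM_apply hξ] at h
      exact (congrArg (fun q => q.1.1) h).symm
    have hξ' : ξ.1.1 ∈ (extChartAt 𝓘(ℝ, E) x).source := by rwa [extChartAt_source]
    refine hΓ z (e ▸ (extChartAt 𝓘(ℝ, E) x).map_source hξ') ξ ?_ z u v w h
    rw [e, (extChartAt 𝓘(ℝ, E) x).left_inv hξ']
  refine ⟨Γ, ?_, h2⟩
  have hS : ContDiffOn ℝ ∞ (fun q => chartT2M x (sectionAct s.toFun ((chartT2M x).symm q)))
      (chartT2M x).target := by
    rw [← contMDiffOn_iff_contDiffOn]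
    have a1 := contMDiffOn_extChartAt_symm (I := 𝓘(ℝ, E).tangent.tangent) (n := ∞)
      (⟨⟨x, 0⟩, 0⟩ : T2 E M)
    have a2 := contMDiffOn_extChartAt (I := 𝓘(ℝ, E).tangent.tangent) (n := ∞)
      (x := (⟨⟨x, 0⟩, 0⟩ : T2 E M))
    refine a2.comp (s.smooth.comp_contMDiffOn a1) ?_
    intro q hq
    have := (mem_chartT2M_source).1 ((chartT2M x).map_target hq)
    rw [mem_preimage, ← extChartAt_source 𝓘(ℝ, E).tangent.tangent]
    refine mem_chartT2M_source.2 ?_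
    rw [sectionAct_base]
    exact this
  -- In finite dimension smoothness of `Γ` may be tested on fixed `v` and `u`. There `Γ z v u` is
  -- the last coordinate of the image of `(z, u, v, 0)`, hence smooth in `z`.
  rw [contDiffOn_clm_apply]
  intro v
  rw [contDiffOn_clm_apply]
  intro u
  have a3 : ContDiffOn ℝ ∞ (fun z : E => (((z, u), (v, 0)) : (E × E) × (E × E)))
      (extChartAt 𝓘(ℝ, E) x).target := by fun_prop
  have a4 := (hS.comp a3 (fun z hz => mem_chartT2M_target.2 hz)).snd.snd
  refine a4.congr fun z hz => ?_
  have hz' : (((z, u), (v, 0)) : (E × E) × (E × E)) ∈ (chartT2M x).target :=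
    mem_chartT2M_target.2 hz
  have := h2 ((chartT2M x).symm ((z, u), (v, 0)))
    (mem_chartT2M_source.1 ((chartT2M x).map_target hz')) z u v 0 ((chartT2M x).right_inv hz')
  simp only [Function.comp]
  rw [this]
  simp

end SymmetryJet

/-! ### Vector fields and Lie brackets in a chart -/

/-- A vector field in the preferred chart of `M` at `x`. -/
noncomputable def fieldCoord (x : M) (Y : ∀ y : M, TangentSpace 𝓘(ℝ, E) y) (z : E) : E :=
  vcoord 𝓘(ℝ, E) x ((extChartAt 𝓘(ℝ, E) x).symm z) (Y ((extChartAt 𝓘(ℝ, E) x).symm z))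

theorem mem_extChartAt_source_of_mem {M : Type*} [TopologicalSpace M] [ChartedSpace E M]
    {x y : M} (hy : y ∈ (chartAt E x).source) :
    y ∈ (extChartAt 𝓘(ℝ, E) x).source := by rwa [extChartAt_source]

theorem T1_ext {M : Type*} [TopologicalSpace M] [ChartedSpace E M]
    {v w : T1 E M} (h : v.1 = w.1) (h' : @Eq E v.2 w.2) : v = w := by
  obtain ⟨v, a⟩ := v
  obtain ⟨w, c⟩ := w
  obtain rfl : v = w := h
  obtain rfl : a = c := h'
  rfl

theorem fieldCoord_extChartAt {M : Type*} [TopologicalSpace M] [ChartedSpace E M] {x y : M}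
    (hy : y ∈ (chartAt E x).source)
    (Y : ∀ y : M, TangentSpace 𝓘(ℝ, E) y) :
    fieldCoord x Y (extChartAt 𝓘(ℝ, E) x y) = vcoord 𝓘(ℝ, E) x y (Y y) := by
  rw [fieldCoord, (extChartAt 𝓘(ℝ, E) x).left_inv (mem_extChartAt_source_of_mem hy)]

theorem chartTM_toSection {x y : M} (hy : y ∈ (chartAt E x).source)
    (Y : ∀ y : M, TangentSpace 𝓘(ℝ, E) y) :
    chartTM x (toSection Y y) =
      (extChartAt 𝓘(ℝ, E) x y, fieldCoord x Y (extChartAt 𝓘(ℝ, E) x y)) := by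
  rw [fieldCoord_extChartAt hy]
  exact chartTM_apply (p := toSection Y y) hy

/-- Used in both directions: the covariant derivative of a field is seen to be differentiable only
through its coordinate expression. -/
theorem mdifferentiableAt_toSection_iff {x y : M} (hy : y ∈ (chartAt E x).source)
    (Y : ∀ y : M, TangentSpace 𝓘(ℝ, E) y) :
    MDifferentiableAt 𝓘(ℝ, E) 𝓘(ℝ, E).tangent (toSection Y) y ↔
      DifferentiableAt ℝ (fieldCoord x Y) (extChartAt 𝓘(ℝ, E) x y) := by
  have hy' := mem_extChartAt_source_of_mem hy
  constructor
  · intro h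
    rw [← mdifferentiableAt_iff_differentiableAt]
    have h1 := mdifferentiableAt_extChartAt_symm' 𝓘(ℝ, E) ((extChartAt 𝓘(ℝ, E) x).map_source hy')
    have h2 : MDifferentiableAt 𝓘(ℝ, E) 𝓘(ℝ, E × E) (fun y' => chartTM x (toSection Y y')) y :=
      (mdifferentiableAt_extChartAt ((mem_source_tangent 𝓘(ℝ, E)
        (p := (⟨x, 0⟩ : T1 E M)) (q := toSection Y y)).2 hy)).comp y h
    have h3 : MDifferentiableAt 𝓘(ℝ, E) 𝓘(ℝ, E)
        (fun y' => ContinuousLinearMap.snd ℝ E E (chartTM x (toSection Y y'))) y :=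
      (ContinuousLinearMap.snd ℝ E E).mdifferentiableAt.comp y h2
    rw [← (extChartAt 𝓘(ℝ, E) x).left_inv hy'] at h3
    have h4 := MDifferentiableAt.comp _ h3 h1
    refine h4.congr_of_eventuallyEq ?_
    filter_upwards [(isOpen_extChartAt_target (I := 𝓘(ℝ, E)) x).mem_nhds
      ((extChartAt 𝓘(ℝ, E) x).map_source hy')] with z hz
    have hm : (extChartAt 𝓘(ℝ, E) x).symm z ∈ (chartAt E x).source := by
      simpa using (extChartAt 𝓘(ℝ, E) x).map_target hz
    rw [Function.comp_apply, chartTM_toSection hm, (extChartAt 𝓘(ℝ, E) x).right_inv hz]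
    rfl
  · intro h
    refine (Trivialization.mdifferentiableAt_section_iff 𝓘(ℝ, E)
      (trivializationAt E (TangentSpace 𝓘(ℝ, E)) x) Y hy).2 ?_
    have h1 := h.mdifferentiableAt.comp y (mdifferentiableAt_extChartAt (I := 𝓘(ℝ, E)) hy)
    refine h1.congr_of_eventuallyEq ?_
    filter_upwards [(chartAt E x).open_source.mem_nhds hy] with y' hy'
    have h2 := congrArg Prod.snd (chartTM_toSection hy' Y)
    rw [chartTM, FiberBundle.extChartAt] at h2
    exact h2

theorem contDiffOn_fieldCoord {Y : ∀ y : M, TangentSpace 𝓘(ℝ, E) y}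
    (hY : ContMDiff 𝓘(ℝ, E) 𝓘(ℝ, E).tangent ∞ (toSection Y)) (x : M) :
    ContDiffOn ℝ ∞ (fieldCoord x Y) (extChartAt 𝓘(ℝ, E) x).target := by
  have h1 : ContMDiffOn 𝓘(ℝ, E) 𝓘(ℝ, E × E) ∞
      (fun z => chartTM x (toSection Y ((extChartAt 𝓘(ℝ, E) x).symm z)))
      (extChartAt 𝓘(ℝ, E) x).target := by
    have a1 := contMDiffOn_extChartAt_symm (I := 𝓘(ℝ, E)) (n := ∞) x
    have a2 := contMDiffOn_extChartAt (I := 𝓘(ℝ, E).tangent) (n := ∞) (x := (⟨x, 0⟩ : T1 E M))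
    refine a2.comp (hY.comp_contMDiffOn a1) ?_
    intro z hz
    refine (mem_source_tangent 𝓘(ℝ, E) (p := (⟨x, 0⟩ : T1 E M))).2 ?_
    have := (extChartAt 𝓘(ℝ, E) x).map_target hz
    rwa [extChartAt_source] at this
  refine h1.contDiffOn.snd.congr fun z hz => ?_
  have hm : (extChartAt 𝓘(ℝ, E) x).symm z ∈ (chartAt E x).source := by
    simpa using (extChartAt 𝓘(ℝ, E) x).map_target hz
  rw [chartTM_toSection hm, (extChartAt 𝓘(ℝ, E) x).right_inv hz]

theorem vcoord_mfderiv_toSection {x y : M} (hy : y ∈ (chartAt E x).source)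
    {Y : ∀ y : M, TangentSpace 𝓘(ℝ, E) y}
    (hY : MDifferentiableAt 𝓘(ℝ, E) 𝓘(ℝ, E).tangent (toSection Y) y)
    (V : TangentSpace 𝓘(ℝ, E) y) :
    vcoord 𝓘(ℝ, E).tangent (⟨x, 0⟩ : T1 E M) (toSection Y y)
      (mfderiv 𝓘(ℝ, E) 𝓘(ℝ, E).tangent (toSection Y) y V) =
      ((vcoord 𝓘(ℝ, E) x y V,
        fderiv ℝ (fieldCoord x Y) (extChartAt 𝓘(ℝ, E) x y) (vcoord 𝓘(ℝ, E) x y V)) : E × E) := by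
  have h1 := vcoord_tangentMap 𝓘(ℝ, E).tangent (x := (⟨x, 0⟩ : T1 E M)) hY
    ((mem_source_tangent 𝓘(ℝ, E) (p := (⟨x, 0⟩ : T1 E M)) (q := toSection Y y)).2 hy) V
  refine h1.trans ?_
  have h2 : (fun y' => chartTM x (toSection Y y')) =ᶠ[𝓝 y]
      (fun z => (z, fieldCoord x Y z)) ∘ extChartAt 𝓘(ℝ, E) x := by
    filter_upwards [(chartAt E x).open_source.mem_nhds hy] with y' hy'
    exact chartTM_toSection hy' Y
  rw [h2.mfderiv_eq]
  have h3 := (mdifferentiableAt_toSection_iff hy Y).1 hY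
  have h4 := (hasFDerivAt_id (𝕜 := ℝ) (extChartAt 𝓘(ℝ, E) x y)).prodMk h3.hasFDerivAt
  have h5 := mfderiv_comp y h4.differentiableAt.mdifferentiableAt
    (mdifferentiableAt_extChartAt (I := 𝓘(ℝ, E)) hy)
  refine (DFunLike.congr_fun h5 V).trans ?_
  rw [mfderiv_eq_fderiv]
  erw [h4.fderiv]
  rfl

theorem mlieBracket_vectorSpace (V W : ∀ z : E, TangentSpace 𝓘(ℝ, E) z) (z : E) :
    VectorField.mlieBracket 𝓘(ℝ, E) V W z =
      fderiv ℝ (F := E) W z (V z) - fderiv ℝ (F := E) V z (W z) := by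
  rw [← VectorField.mlieBracketWithin_univ, VectorField.mlieBracketWithin_eq_lieBracketWithin]
  exact congrFun VectorField.lieBracketWithin_univ z

/-- The bracket is natural under pullback by the inverse chart, and on a vector space it is `DW(X) -
DX(W)`. -/
theorem vcoord_mlieBracket [CompleteSpace E] {x y : M} (hy : y ∈ (chartAt E x).source)
    {X W : ∀ y : M, TangentSpace 𝓘(ℝ, E) y}
    (hX : MDifferentiableAt 𝓘(ℝ, E) 𝓘(ℝ, E).tangent (toSection X) y)
    (hW : MDifferentiableAt 𝓘(ℝ, E) 𝓘(ℝ, E).tangent (toSection W) y) :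
    vcoord 𝓘(ℝ, E) x y (VectorField.mlieBracket 𝓘(ℝ, E) X W y) =
      fderiv ℝ (fieldCoord x W) (extChartAt 𝓘(ℝ, E) x y)
        (fieldCoord x X (extChartAt 𝓘(ℝ, E) x y)) -
      fderiv ℝ (fieldCoord x X) (extChartAt 𝓘(ℝ, E) x y)
        (fieldCoord x W (extChartAt 𝓘(ℝ, E) x y)) := by
  have hy' := mem_extChartAt_source_of_mem hy
  set z := extChartAt 𝓘(ℝ, E) x y with hz
  have hzt : z ∈ (extChartAt 𝓘(ℝ, E) x).target := (extChartAt 𝓘(ℝ, E) x).map_source hy'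
  have hzy : (extChartAt 𝓘(ℝ, E) x).symm z = y := (extChartAt 𝓘(ℝ, E) x).left_inv hy'
  -- Pulling back by the inverse chart applies the inverse of its derivative, which is the
  -- derivative of the chart.
  have hinv : ∀ z' ∈ (extChartAt 𝓘(ℝ, E) x).target,
      ∀ V : ∀ y : M, TangentSpace 𝓘(ℝ, E) y,
      VectorField.mpullback 𝓘(ℝ, E) 𝓘(ℝ, E) (extChartAt 𝓘(ℝ, E) x).symm V z' =
        fieldCoord x V z' := by
    intro z' hz' V
    have e1 := mfderiv_extChartAt_comp_mfderivWithin_extChartAt_symm (I := 𝓘(ℝ, E)) hz'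
    have e2 := mfderivWithin_extChartAt_symm_comp_mfderiv_extChartAt (I := 𝓘(ℝ, E)) hz'
    rw [𝓘(ℝ, E).range_eq_univ, mfderivWithin_univ] at e1 e2
    rw [VectorField.mpullback_apply, ContinuousLinearMap.inverse_eq e2 e1]
    rfl
  have h2n : minSmoothness ℝ 2 ≤ (∞ : WithTop ℕ∞) := by
    rw [minSmoothness_of_isRCLikeNormedField]
    exact WithTop.coe_le_coe.2 le_top
  have : IsManifold 𝓘(ℝ, E) (minSmoothness ℝ 2) M := IsManifold.of_le h2n
  have h1 := VectorField.mpullback_mlieBracket (I := 𝓘(ℝ, E)) (I' := 𝓘(ℝ, E)) (n := ∞)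
    (f := (extChartAt 𝓘(ℝ, E) x).symm) (x₀ := z) (V := X) (W := W)
    (by rw [hzy]; exact hX) (by rw [hzy]; exact hW)
    ((contMDiffOn_extChartAt_symm x).contMDiffAt (extChartAt_target_mem_nhds' hzt)) h2n
  have hev : ∀ V : ∀ y : M, TangentSpace 𝓘(ℝ, E) y,
      VectorField.mpullback 𝓘(ℝ, E) 𝓘(ℝ, E) (extChartAt 𝓘(ℝ, E) x).symm V =ᶠ[𝓝 z]
        fieldCoord x V := fun V => by
    filter_upwards [(isOpen_extChartAt_target (I := 𝓘(ℝ, E)) x).mem_nhds hzt] with z' hz'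
    exact hinv z' hz' V
  rw [hinv z hzt, hz, fieldCoord_extChartAt hy, ← hz] at h1
  rw [h1, (hev X).mlieBracket_vectorField_eq (hev W)]
  exact mlieBracket_vectorSpace (fieldCoord x X) (fieldCoord x W) z

/-! ### Image of a vector field under a local bisection -/

namespace LocalBisection

variable {y : M} (b : LocalBisection E y)

theorem pushforward_base (Y : ∀ y : M, TangentSpace 𝓘(ℝ, E) y) {m : M} (hm : m ∈ b.base.target) :
    toSection (b.pushforward Y) m = b.toFun (toSection Y (b.base.symm m)) := by
  -- The transport in the definition of `pushforward` disappears in the total space.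
  have key : ∀ (n : M) (h : n = m) (v : TangentSpace 𝓘(ℝ, E) n),
      (⟨m, h ▸ v⟩ : T1 E M) = ⟨n, v⟩ := by
    rintro n rfl v
    rfl
  have h : b.pushforward Y m =
      b.base.right_inv hm ▸ b.lin (b.base.symm m) (Y (b.base.symm m)) := dif_pos hm
  rw [toSection, h]
  exact key _ (b.base.right_inv hm) _

/-- Near `y` the image field is `b ∘ Y ∘ b.base.symm`. Since `b.base` has differential `-I` at its
fixed point `y`, so has its inverse, which is the source of the sign in `-V`. -/
theorem tangentMap_toSection_pushforward (hp : b.base y = y)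
    (hps : ∀ V : TangentSpace 𝓘(ℝ, E) y,
      tangentMap 𝓘(ℝ, E) 𝓘(ℝ, E) b.base ⟨y, V⟩ = ⟨y, -V⟩)
    {Y : ∀ y : M, TangentSpace 𝓘(ℝ, E) y}
    (hY : MDifferentiableAt 𝓘(ℝ, E) 𝓘(ℝ, E).tangent (toSection Y) y)
    (V : TangentSpace 𝓘(ℝ, E) y) :
    MDifferentiableAt 𝓘(ℝ, E) 𝓘(ℝ, E).tangent (toSection (b.pushforward Y)) y ∧
    tangentMap 𝓘(ℝ, E) 𝓘(ℝ, E).tangent (toSection (b.pushforward Y)) ⟨y, V⟩ =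
      tangentMap 𝓘(ℝ, E).tangent 𝓘(ℝ, E).tangent b.toFun
        (tangentMap 𝓘(ℝ, E) 𝓘(ℝ, E).tangent (toSection Y) ⟨y, -V⟩) := by
  have hyt : y ∈ b.base.target := by
    have := b.base.map_source b.mem_source
    rwa [hp] at this
  have hsy : b.base.symm y = y := by
    have := b.base.left_inv b.mem_source
    rwa [hp] at this
  have hbd : MDifferentiableAt 𝓘(ℝ, E) 𝓘(ℝ, E) b.base y :=
    (b.contMDiffOn_base.contMDiffAt
      (b.base.open_source.mem_nhds b.mem_source)).mdifferentiableAt (by simp)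
  have hsd : MDifferentiableAt 𝓘(ℝ, E) 𝓘(ℝ, E) b.base.symm y :=
    (b.contMDiffOn_base_symm.contMDiffAt
      (b.base.open_target.mem_nhds hyt)).mdifferentiableAt (by simp)
  have hst : tangentMap 𝓘(ℝ, E) 𝓘(ℝ, E) b.base.symm ⟨y, V⟩ = ⟨y, -V⟩ := by
    have h1 : tangentMap 𝓘(ℝ, E) 𝓘(ℝ, E) (b.base.symm ∘ b.base) (⟨y, -V⟩ : T1 E M) =
        tangentMap 𝓘(ℝ, E) 𝓘(ℝ, E) b.base.symm
          (tangentMap 𝓘(ℝ, E) 𝓘(ℝ, E) b.base (⟨y, -V⟩ : T1 E M)) :=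
      tangentMap_comp_at (⟨y, -V⟩ : T1 E M) (by rw [hp]; exact hsd) hbd
    rw [hps, neg_neg] at h1
    rw [← h1]
    have h2 : (b.base.symm ∘ b.base) =ᶠ[𝓝 y] id := by
      filter_upwards [b.base.open_source.mem_nhds b.mem_source] with m hm
      exact b.base.left_inv hm
    have h3 := h2.mfderiv_eq (I := 𝓘(ℝ, E)) (I' := 𝓘(ℝ, E))
    refine T1_ext h2.eq_of_nhds ?_
    refine (DFunLike.congr_fun h3 (-V)).trans ?_
    rw [mfderiv_id]
    rfl
  have hev : toSection (b.pushforward Y) =ᶠ[𝓝 y] b.toFun ∘ (toSection Y ∘ b.base.symm) := by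
    filter_upwards [b.base.open_target.mem_nhds hyt] with m hm
    exact b.pushforward_base Y hm
  have hYs : MDifferentiableAt 𝓘(ℝ, E) 𝓘(ℝ, E).tangent (toSection Y) (b.base.symm y) := by
    rwa [hsy]
  have hbf : MDifferentiableAt 𝓘(ℝ, E).tangent 𝓘(ℝ, E).tangent b.toFun
      ((toSection Y ∘ b.base.symm) y) := by
    rw [Function.comp_apply, hsy]
    exact b.mdifferentiableAt_toFun (Y y)
  refine ⟨(hbf.comp y (hYs.comp y hsd)).congr_of_eventuallyEq hev, ?_⟩
  rw [← hst, ← tangentMap_comp_at (⟨y, V⟩ : T1 E M) hYs hsd,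
    ← tangentMap_comp_at (⟨y, V⟩ : T1 E M) hbf (hYs.comp y hsd)]
  exact T2_ext hev.eq_of_nhds (DFunLike.congr_fun hev.mfderiv_eq V)

end LocalBisection

theorem chartT2M_tangentMap_toSection {x y : M} (hy : y ∈ (chartAt E x).source)
    {Y : ∀ y : M, TangentSpace 𝓘(ℝ, E) y}
    (hY : MDifferentiableAt 𝓘(ℝ, E) 𝓘(ℝ, E).tangent (toSection Y) y)
    (V : TangentSpace 𝓘(ℝ, E) y) :
    chartT2M x (tangentMap 𝓘(ℝ, E) 𝓘(ℝ, E).tangent (toSection Y) ⟨y, V⟩) =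
      ((extChartAt 𝓘(ℝ, E) x y, fieldCoord x Y (extChartAt 𝓘(ℝ, E) x y)),
        (vcoord 𝓘(ℝ, E) x y V, fderiv ℝ (fieldCoord x Y) (extChartAt 𝓘(ℝ, E) x y)
          (vcoord 𝓘(ℝ, E) x y V))) := by
  refine (chartT2M_apply (x := x)
    (ξ := tangentMap 𝓘(ℝ, E) 𝓘(ℝ, E).tangent (toSection Y) ⟨y, V⟩) hy).trans ?_
  exact Prod.ext (chartTM_toSection hy Y) (vcoord_mfderiv_toSection hy hY V)

/-! ### The connection and its curvature in coordinates -/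

namespace SymmetryJet

variable (s : SymmetryJet E M)

/-- `Γ` is the bilinear part of the action of the symmetry jet `s` on `T²M`, in the preferred
chart of `M` at `x`. -/
def IsSymbol (x : M) (Γ : E → E →L[ℝ] E →L[ℝ] E) : Prop :=
  ∀ (ξ : T2 E M), ξ.1.1 ∈ (chartAt E x).source → ∀ z u v w : E,
    chartT2M x ξ = ((z, u), (v, w)) →
    chartT2M x (sectionAct s.toFun ξ) = ((z, -u), (-v, -w + Γ z v u))

variable {s} {x y : M} {Γ : E → E →L[ℝ] E →L[ℝ] E} {X Y Z : ∀ y : M, TangentSpace 𝓘(ℝ, E) y}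

/-- The symbol formula is applied to `Y_*(-V)`, with coordinates `(z, Y, -V, -DY(V))`: the last
entry becomes `DY(V) + Γ(-V, Y)`. -/
theorem IsSymbol.fderiv_pushforward (hΓ : s.IsSymbol x Γ) (hy : y ∈ (chartAt E x).source)
    (hY : MDifferentiableAt 𝓘(ℝ, E) 𝓘(ℝ, E).tangent (toSection Y) y)
    (V : TangentSpace 𝓘(ℝ, E) y) :
    fderiv ℝ (fieldCoord x ((s.rep y).pushforward Y)) (extChartAt 𝓘(ℝ, E) x y)
      (vcoord 𝓘(ℝ, E) x y V) =
    fderiv ℝ (fieldCoord x Y) (extChartAt 𝓘(ℝ, E) x y) (vcoord 𝓘(ℝ, E) x y V) -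
      Γ (extChartAt 𝓘(ℝ, E) x y) (vcoord 𝓘(ℝ, E) x y V)
        (fieldCoord x Y (extChartAt 𝓘(ℝ, E) x y)) := by
  have hp : (s.rep y).base y = y := congrArg (fun v : T1 E M => v.1) (s.rep_toFun y 0)
  obtain ⟨h1, h2⟩ := (s.rep y).tangentMap_toSection_pushforward hp (s.tangentMap_rep_base y) hY V
  have h3 := chartT2M_tangentMap_toSection hy h1 V
  have h4 := chartT2M_tangentMap_toSection hy hY (-V)
  have h5 := hΓ _ hy _ _ _ _ h4
  rw [sectionAct_eq] at h5
  have h6 := congrArg (fun q => q.2.2) (h3.symm.trans ((congrArg (chartT2M x) h2).trans h5))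
  refine h6.trans ?_
  simp only [map_neg, neg_neg, neg_apply]
  abel

theorem IsSymbol.vcoord_nabla [CompleteSpace E] (hΓ : s.IsSymbol x Γ)
    (hy : y ∈ (chartAt E x).source)
    (hX : MDifferentiableAt 𝓘(ℝ, E) 𝓘(ℝ, E).tangent (toSection X) y)
    (hY : MDifferentiableAt 𝓘(ℝ, E) 𝓘(ℝ, E).tangent (toSection Y) y) :
    vcoord 𝓘(ℝ, E) x y (s.nabla X Y y) =
      flatNabla Γ (fieldCoord x X) (fieldCoord x Y) (extChartAt 𝓘(ℝ, E) x y) := by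
  have hp : (s.rep y).base y = y := congrArg (fun v : T1 E M => v.1) (s.rep_toFun y 0)
  set W := (s.rep y).pushforward Y with hW
  have hWd : MDifferentiableAt 𝓘(ℝ, E) 𝓘(ℝ, E).tangent (toSection W) y :=
    ((s.rep y).tangentMap_toSection_pushforward hp (s.tangentMap_rep_base y) hY 0).1
  have hdY := (mdifferentiableAt_toSection_iff hy Y).1 hY
  have hdW := (mdifferentiableAt_toSection_iff hy W).1 hWd
  have hadd : fieldCoord x (Y + W) = fieldCoord x Y + fieldCoord x W := by
    funext z
    exact map_add _ _ _
  have hsum : MDifferentiableAt 𝓘(ℝ, E) 𝓘(ℝ, E).tangent (toSection (Y + W)) y := by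
    rw [mdifferentiableAt_toSection_iff hy, hadd]
    exact hdY.add hdW
  have hyt : y ∈ (s.rep y).base.target := by
    have := (s.rep y).base.map_source (s.rep y).mem_source
    rwa [hp] at this
  have hsy : (s.rep y).base.symm y = y := by
    have := (s.rep y).base.left_inv (s.rep y).mem_source
    rwa [hp] at this
  -- At `y` the bisection is `-I`, so `Y + W` vanishes there and the bracket loses its term in the
  -- derivative of `X`.
  have h0 : fieldCoord x (Y + W) (extChartAt 𝓘(ℝ, E) x y) = 0 := by
    have h1 := (s.rep y).pushforward_base Y hyt
    rw [hsy] at h1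
    have h2 := congrArg (fun p => (chartTM x p).2) (h1.trans (s.rep_toFun y (Y y)))
    rw [chartTM_toSection hy, chartTM_apply (p := ⟨y, -Y y⟩) hy, map_neg] at h2
    rw [hadd, Pi.add_apply, fieldCoord_extChartAt hy Y]
    exact (congrArg (_ + ·) h2).trans (add_neg_cancel _)
  have h3 := vcoord_mlieBracket hy hX hsum
  rw [h0, map_zero, sub_zero, hadd, fderiv_add hdY hdW] at h3
  have h4 := hΓ.fderiv_pushforward hy hY (X y)
  rw [← fieldCoord_extChartAt hy, ← hW] at h4
  rw [nabla, map_smul, ← hW, h3, add_apply, h4, flatNabla]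
  module

theorem IsSymbol.curvature_eq [CompleteSpace E] (hΓ : s.IsSymbol x Γ)
    (hd : DifferentiableAt ℝ Γ (extChartAt 𝓘(ℝ, E) x x))
    (hX : ContMDiff 𝓘(ℝ, E) 𝓘(ℝ, E).tangent ∞ (toSection X))
    (hY : ContMDiff 𝓘(ℝ, E) 𝓘(ℝ, E).tangent ∞ (toSection Y))
    (hZ : ContMDiff 𝓘(ℝ, E) 𝓘(ℝ, E).tangent ∞ (toSection Z)) :
    @Eq E (s.curvature X Y Z x)
      ((1 / 4 : ℝ) • (
        (2 : ℝ) • fderiv ℝ Γ (extChartAt 𝓘(ℝ, E) x x) (Y x) (X x) (Z x) -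
        (2 : ℝ) • fderiv ℝ Γ (extChartAt 𝓘(ℝ, E) x x) (X x) (Y x) (Z x) +
        Γ (extChartAt 𝓘(ℝ, E) x x) (X x) (Γ (extChartAt 𝓘(ℝ, E) x x) (Y x) (Z x)) -
        Γ (extChartAt 𝓘(ℝ, E) x x) (Y x) (Γ (extChartAt 𝓘(ℝ, E) x x) (X x) (Z x)))) := by
  have hx : x ∈ (chartAt E x).source := mem_chart_source E x
  have hxt := extChartAt_target_mem_nhds (I := 𝓘(ℝ, E)) x
  have cX := (contDiffOn_fieldCoord hX x).contDiffAt hxt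
  have cY := (contDiffOn_fieldCoord hY x).contDiffAt hxt
  have cZ := (contDiffOn_fieldCoord hZ x).contDiffAt hxt
  have dX := cX.differentiableAt (by simp)
  have dY := cY.differentiableAt (by simp)
  have vX := fieldCoord_extChartAt hx X
  have vY := fieldCoord_extChartAt hx Y
  have vZ := fieldCoord_extChartAt hx Z
  rw [vcoord_self] at vX vY vZ
  -- The coordinate formula for the connection holds throughout the chart domain, each point using
  -- its own representative bisection, so it may be differentiated once more at `x`.
  have key : ∀ {V : ∀ y : M, TangentSpace 𝓘(ℝ, E) y}
      (_ : ContMDiff 𝓘(ℝ, E) 𝓘(ℝ, E).tangent ∞ (toSection V))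
      (_ : DifferentiableAt ℝ (fieldCoord x V) (extChartAt 𝓘(ℝ, E) x x)),
      MDifferentiableAt 𝓘(ℝ, E) 𝓘(ℝ, E).tangent (toSection (s.nabla V Z)) x ∧
      fieldCoord x (s.nabla V Z) =ᶠ[𝓝 (extChartAt 𝓘(ℝ, E) x x)]
        flatNabla Γ (fieldCoord x V) (fieldCoord x Z) := by
    intro V hV dV
    have h1 : fieldCoord x (s.nabla V Z) =ᶠ[𝓝 (extChartAt 𝓘(ℝ, E) x x)]
        flatNabla Γ (fieldCoord x V) (fieldCoord x Z) := by
      filter_upwards [hxt] with z hz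
      have hm : (extChartAt 𝓘(ℝ, E) x).symm z ∈ (chartAt E x).source := by
        simpa using (extChartAt 𝓘(ℝ, E) x).map_target hz
      have h2 := hΓ.vcoord_nabla hm (hV.mdifferentiable (by simp) _)
        (hZ.mdifferentiable (by simp) _)
      rwa [(extChartAt 𝓘(ℝ, E) x).right_inv hz] at h2
    obtain ⟨L, hL, -⟩ := hasFDerivAt_flatNabla hd dV cZ
    exact ⟨(mdifferentiableAt_toSection_iff hx _).2
      (hL.differentiableAt.congr_of_eventuallyEq h1), h1⟩
  obtain ⟨mY, eY⟩ := key hY dY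
  obtain ⟨mX, eX⟩ := key hX dX
  have mX' := hX.mdifferentiable (by simp) x
  have mY' := hY.mdifferentiable (by simp) x
  have mZ' := hZ.mdifferentiable (by simp) x
  have mB : MDifferentiableAt 𝓘(ℝ, E) 𝓘(ℝ, E).tangent
      (toSection (VectorField.mlieBracket 𝓘(ℝ, E) X Y)) x := by
    have : IsManifold 𝓘(ℝ, E) ((∞ : WithTop ℕ∞) + 1) M := by simpa
    have : IsManifold 𝓘(ℝ, E) (minSmoothness ℝ 2) M := by
      rw [minSmoothness_of_isRCLikeNormedField]
      exact IsManifold.of_le (n := ∞) (WithTop.coe_le_coe.2 le_top)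
    exact ((hX x).mlieBracket_vectorField (m := 1) (n := ⊤) (hY x) (by
      rw [minSmoothness_of_isRCLikeNormedField]
      exact WithTop.coe_le_coe.2 le_top)).mdifferentiableAt (by simp)
  have b1 := hΓ.vcoord_nabla hx mX' mY
  have b2 := hΓ.vcoord_nabla hx mY' mX
  have b3 := hΓ.vcoord_nabla hx mB mZ'
  have b4 := fieldCoord_extChartAt hx (VectorField.mlieBracket 𝓘(ℝ, E) X Y)
  rw [vcoord_mlieBracket hx mX' mY'] at b4
  rw [vcoord_self, flatNabla_apply] at b1 b2 b3
  rw [eY.fderiv_eq, eY.eq_of_nhds] at b1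
  rw [eX.fderiv_eq, eX.eq_of_nhds] at b2
  rw [b4] at b3
  have h := flatNabla_curvature hd dX dY cZ
  rw [flatNabla_apply Γ _ (flatNabla _ _ _), flatNabla_apply Γ _ (flatNabla _ _ _), vX, vY,
    vZ] at h
  rw [vX, vY, vZ] at b3
  rw [vX] at b1
  rw [vY] at b2
  rw [curvature, b1, b2, b3]
  exact h

end SymmetryJet

/-! ### Coordinates on `T³M`, translations and the difference map -/

theorem T3_ext {ζ η : T3 E M} (h : ζ.1 = η.1)
    (h' : @Eq ((E × E) × (E × E)) ζ.2 η.2) : ζ = η := by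
  obtain ⟨v, a⟩ := ζ
  obtain ⟨w, c⟩ := η
  obtain rfl : v = w := h
  obtain rfl : a = c := h'
  rfl

theorem chartT2M_self (x : M) (u v w : E) :
    chartT2M x (⟨⟨x, u⟩, ((v, w) : E × E)⟩ : T2 E M) =
      ((extChartAt 𝓘(ℝ, E) x x, u), (v, w)) := by
  refine (extChartAt_tangent_self 𝓘(ℝ, E).tangent
    (⟨⟨x, u⟩, ((v, w) : E × E)⟩ : T2 E M)).trans (Prod.ext ?_ rfl)
  exact extChartAt_tangent_self 𝓘(ℝ, E) (⟨x, u⟩ : T1 E M)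

/-- The induced chart of `T²M` depends only on the foot point in `M`, so the chart at the zero
vector over `x` is also the preferred chart at every `η` over `x`. -/
theorem vcoord_T2_self {x : M} {η : T2 E M} (h : η.1.1 = x)
    (ν : TangentSpace 𝓘(ℝ, E).tangent.tangent η) :
    @Eq ((E × E) × (E × E))
      (vcoord 𝓘(ℝ, E).tangent.tangent (⟨⟨x, 0⟩, 0⟩ : T2 E M) η ν) ν := by
  subst h
  exact vcoord_self 𝓘(ℝ, E).tangent.tangent η ν

/-- The vector of `T³M` over `x` with the given coordinates in the chart of `T³M` induced by the
preferred chart of `M` at `x`. -/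
noncomputable def point3 (x : M) (u v w x' u' v' w' : E) : T3 E M :=
  ⟨⟨⟨x, u⟩, ((v, w) : E × E)⟩, (((x', u'), (v', w')) : (E × E) × (E × E))⟩

theorem kappa_point3 (x : M) (u v w x' u' v' w' : E) :
    kappa 𝓘(ℝ, E).tangent (point3 x u v w x' u' v' w') = point3 x u x' u' v w v' w' := rfl

theorem translate_point3 (x : M) (u v w x' u' v' w' V : E) :
    translate (point3 x u v w x' u' v' w') V = point3 x u v w x' u' v' (w' + V) := by
  refine T3_ext rfl ?_
  have h1 := vlift_eq 𝓘(ℝ, E) (⟨x, u⟩ : T1 E M) V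
  have h2 := vlift_eq 𝓘(ℝ, E).tangent (point3 x u v w x' u' v' w').1
    (vlift 𝓘(ℝ, E) (⟨x, u⟩ : T1 E M) V)
  refine (congrArg (fun a : (E × E) × (E × E) => ((x', u'), (v', w')) + a) h2).trans ?_
  rw [h1]
  simp only [Prod.mk_add_mk, add_zero]
  rfl

/-- Translation adds `V` to the last coordinate, so the vector picked by choice is forced. -/
theorem Pi3_point3 (x : M) (u v w x' u' v' w₁ w₂ : E) :
    Pi3 (point3 x u v w x' u' v' w₁) (point3 x u v w x' u' v' w₂) = ⟨x, w₁ - w₂⟩ := by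
  have h : ∃ V, point3 x u v w x' u' v' w₁ = translate (point3 x u v w x' u' v' w₂) V :=
    ⟨w₁ - w₂, by erw [translate_point3, add_sub_cancel]⟩
  have h1 := h.choose_spec.trans (translate_point3 x u v w x' u' v' w₂ h.choose)
  have h2 : w₁ = w₂ + (show E from h.choose) :=
    congrArg (fun ζ : T3 E M => Prod.snd (α := E) (β := E)
      (Prod.snd (α := E × E) (β := E × E) ζ.2)) h1
  refine T1_ext rfl ?_
  refine (dif_pos h).trans ?_
  exact eq_sub_of_add_eq' h2.symm

/-- A map constant along the line `u + t V` has zero derivative on its velocity. -/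
theorem mfderiv_comp_vlift {E₁ H₁ N₁ E₂ H₂ N₂ : Type*} [NormedAddCommGroup E₁] [NormedSpace ℝ E₁]
    [TopologicalSpace H₁] (I : ModelWithCorners ℝ E₁ H₁) [TopologicalSpace N₁] [ChartedSpace H₁ N₁]
    [IsManifold I ∞ N₁] [NormedAddCommGroup E₂] [NormedSpace ℝ E₂] [TopologicalSpace H₂]
    (J : ModelWithCorners ℝ E₂ H₂) [TopologicalSpace N₂] [ChartedSpace H₂ N₂]
    {f : TangentBundle I N₁ → N₂} {u : TangentBundle I N₁}
    (hf : MDifferentiableAt I.tangent J f u) (V : TangentSpace I u.1)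
    (hc : ∀ t : ℝ, f ⟨u.1, u.2 + t • V⟩ = f u) :
    mfderiv I.tangent J f u (vlift I u V) = 0 := by
  have hd := mdifferentiableAt_line I u.1 u.2 V 0
  have h0 : (⟨u.1, u.2 + (0 : ℝ) • V⟩ : TangentBundle I N₁) = u := by simp
  have h1 := mfderiv_comp (0 : ℝ) (g := f)
    (f := fun t : ℝ => (⟨u.1, u.2 + t • V⟩ : TangentBundle I N₁)) (by rwa [h0]) hd
  have h2 : f ∘ (fun t : ℝ => (⟨u.1, u.2 + t • V⟩ : TangentBundle I N₁)) = fun _ => f u :=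
    funext hc
  rw [h2, mfderiv_const, h0] at h1
  exact (DFunLike.congr_fun h1 (1 : ℝ)).symm

theorem contMDiff_pStarTwo :
    ContMDiff 𝓘(ℝ, E).tangent.tangent 𝓘(ℝ, E).tangent ∞ (pStarTwo (E := E) (M := M)) :=
  ContMDiff.contMDiff_tangentMap (n := ∞)
    (Bundle.contMDiff_proj (TangentSpace 𝓘(ℝ, E) (M := M))) (by simp)

/-- The translation adds a vector vertical for `T²M → TM`, which `p_*` kills. It is also killed by
`p_**`, because the line generating it is itself in a vertical direction of `TM`, along which
`pStarTwo` is constant. -/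
theorem projections_translate (ζ : T3 E M) (V : TangentSpace 𝓘(ℝ, E) ζ.1.1.1) :
    projections (translate ζ V) = projections ζ := by
  refine Prod.ext rfl (Prod.ext ?_ ?_)
  · refine LocalBisection.T2_ext rfl ?_
    have h := mfderiv_comp_vlift 𝓘(ℝ, E).tangent 𝓘(ℝ, E).tangent (u := ζ.1)
      (f := fun ξ : T2 E M => ξ.1)
      ((Bundle.contMDiffAt_proj (n := 1) (TangentSpace 𝓘(ℝ, E).tangent)).mdifferentiableAt
        (by simp)) (vlift 𝓘(ℝ, E) ζ.1.1 V) (fun _ => rfl)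
    refine (map_add (mfderiv 𝓘(ℝ, E).tangent.tangent 𝓘(ℝ, E).tangent
      (fun ξ : T2 E M => ξ.1) ζ.1) ζ.2 _).trans ?_
    rw [h, add_zero]
    rfl
  · refine LocalBisection.T2_ext rfl ?_
    have h := mfderiv_comp_vlift 𝓘(ℝ, E).tangent 𝓘(ℝ, E).tangent (u := ζ.1)
      (f := pStarTwo (E := E) (M := M)) (contMDiff_pStarTwo.mdifferentiable (by simp) _)
      (vlift 𝓘(ℝ, E) ζ.1.1 V) (fun t => by
        refine T1_ext rfl ?_
        have h1 := mfderiv_comp_vlift 𝓘(ℝ, E) 𝓘(ℝ, E) (u := ζ.1.1)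
          (f := fun v : T1 E M => v.1)
          ((Bundle.contMDiffAt_proj (n := 1) (TangentSpace 𝓘(ℝ, E))).mdifferentiableAt
            (by simp)) V (fun _ => rfl)
        refine (map_add (mfderiv 𝓘(ℝ, E).tangent 𝓘(ℝ, E)
          (fun v : T1 E M => v.1) ζ.1.1) ζ.1.2 _).trans ?_
        rw [map_smul, h1, smul_zero, add_zero]
        rfl)
    refine (map_add (mfderiv 𝓘(ℝ, E).tangent.tangent 𝓘(ℝ, E).tangent
      (pStarTwo (E := E) (M := M)) ζ.1) ζ.2 _).trans ?_
    rw [h, add_zero]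
    rfl

/-- Only three entries are identified, since the others cancel in the commutator. -/
theorem exists_thirdVector_eq_point3 {X Y Z : ∀ y : M, TangentSpace 𝓘(ℝ, E) y}
    (hY : ContMDiff 𝓘(ℝ, E) 𝓘(ℝ, E).tangent ∞ (toSection Y))
    (hZ : ContMDiff 𝓘(ℝ, E) 𝓘(ℝ, E).tangent ∞ (toSection Z)) (x : M) :
    ∃ u v w x' u' v' w' : E, thirdVector X Y Z x = point3 x u v w x' u' v' w' ∧
      @Eq E u (Z x) ∧ @Eq E v (Y x) ∧ @Eq E x' (X x) := by
  have hx : x ∈ (chartAt E x).source := mem_chart_source E x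
  have hsec : ∀ {W : ∀ y : M, TangentSpace 𝓘(ℝ, E) y},
      ContMDiff 𝓘(ℝ, E) 𝓘(ℝ, E).tangent ∞ (toSection W) → ∀ V : TangentSpace 𝓘(ℝ, E) x,
      Prod.fst (α := E) (β := E) (mfderiv 𝓘(ℝ, E) 𝓘(ℝ, E).tangent (toSection W) x V) = V := by
    intro W hW V
    have h1 := vcoord_mfderiv_toSection hx (hW.mdifferentiable (by simp) x) V
    have h2 := vcoord_self 𝓘(ℝ, E).tangent (toSection W x)
      (mfderiv 𝓘(ℝ, E) 𝓘(ℝ, E).tangent (toSection W) x V)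
    have h3 := congrArg Prod.fst (h2.symm.trans h1)
    rwa [vcoord_self] at h3
  set q := mfderiv 𝓘(ℝ, E) 𝓘(ℝ, E).tangent (toSection Y) x (X x) with hq
  set TZ := tangentMap 𝓘(ℝ, E) 𝓘(ℝ, E).tangent (toSection Z) with hTZ
  set ν := mfderiv 𝓘(ℝ, E).tangent 𝓘(ℝ, E).tangent.tangent TZ (toSection Y x) q with hν
  have hTZd : MDifferentiableAt 𝓘(ℝ, E).tangent 𝓘(ℝ, E).tangent.tangent TZ (toSection Y x) :=
    (hZ.contMDiff_tangentMap (m := ∞) (by simp)).mdifferentiable (by simp) _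
  -- `Z_*` covers `Z`, so the projection of `Z_** Y_* X` to `T²M` by `p_*` is `Z_*` of the
  -- projection of `Y_* X`, namely `Z_* X`.
  have h1 : Prod.fst (α := E × E) (β := E × E) ν =
      mfderiv 𝓘(ℝ, E) 𝓘(ℝ, E).tangent (toSection Z) x (X x) := by
    rw [← mfderiv_proj_apply 𝓘(ℝ, E).tangent]
    have e1 := mfderiv_comp (g := fun ξ : T2 E M => ξ.1) (toSection Y x)
      ((Bundle.contMDiffAt_proj (n := 1) (TangentSpace 𝓘(ℝ, E).tangent)).mdifferentiableAt
        (by simp)) hTZd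
    have e2 := mfderiv_comp (g := toSection Z) (f := fun v : T1 E M => v.1) (toSection Y x)
      (hZ.mdifferentiable (by simp) x)
      ((Bundle.contMDiffAt_proj (n := 1) (TangentSpace 𝓘(ℝ, E))).mdifferentiableAt (by simp))
    refine (DFunLike.congr_fun (e1.symm.trans e2) q).trans ?_
    refine congrArg (mfderiv 𝓘(ℝ, E) 𝓘(ℝ, E).tangent (toSection Z) x) ?_
    exact (mfderiv_proj_apply 𝓘(ℝ, E) (toSection Y x) q).trans (hsec hY (X x))
  refine ⟨Z x, Y x, Prod.snd (α := E) (β := E) (mfderiv 𝓘(ℝ, E) 𝓘(ℝ, E).tangent (toSection Z) x (Y x)),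
    X x, Prod.snd (α := E) (β := E) (mfderiv 𝓘(ℝ, E) 𝓘(ℝ, E).tangent (toSection Z) x (X x)),
    Prod.fst (α := E) (β := E) (Prod.snd (α := E × E) (β := E × E) ν),
    Prod.snd (α := E) (β := E) (Prod.snd (α := E × E) (β := E × E) ν), ?_, rfl, rfl, rfl⟩
  refine T3_ext (LocalBisection.T2_ext rfl (Prod.ext (hsec hZ (Y x)) rfl)) (Prod.ext ?_ rfl)
  exact h1.trans (Prod.ext (hsec hZ (X x)) rfl)

/-! ### The actions on `T³M` and their commutator -/

namespace SymmetryJet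

variable {s : SymmetryJet E M} {x : M} {Γ : E → E →L[ℝ] E →L[ℝ] E}

/-- The product rule for the coordinate map `(z, u, v, w) ↦ (z, -u, -v, -w + Γ_z(v, u))` in the
direction `(x', u', v', w')`. -/
theorem IsSymbol.jetAct_point3 (hΓ : s.IsSymbol x Γ)
    (hd : DifferentiableAt ℝ Γ (extChartAt 𝓘(ℝ, E) x x)) (u v w x' u' v' w' : E) :
    s.jetAct (point3 x u v w x' u' v' w') =
      point3 x (-u) (-v) (-w + Γ (extChartAt 𝓘(ℝ, E) x x) v u) x' (-u') (-v')
        (-w' + (fderiv ℝ Γ (extChartAt 𝓘(ℝ, E) x x) x' v u + Γ (extChartAt 𝓘(ℝ, E) x x) v' u +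
          Γ (extChartAt 𝓘(ℝ, E) x x) v u')) := by
  set z := extChartAt 𝓘(ℝ, E) x x with hz
  have hx : x ∈ (chartAt E x).source := mem_chart_source E x
  set ξ : T2 E M := ⟨⟨x, u⟩, ((v, w) : E × E)⟩ with hξ
  have hs1 : (sectionAct s.toFun ξ).1.1 = x := congrArg (fun p : T1 E M => p.1) (s.sectionAct_base ξ)
  have h1 := hΓ ξ hx z u v w (chartT2M_self x u v w)
  refine T3_ext ?_ ?_
  · refine (chartT2M x).injOn (mem_chartT2M_source.2 (hs1.symm ▸ hx))
      (mem_chartT2M_source.2 hx) (h1.trans (chartT2M_self x _ _ _).symm)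
  · have hsd := s.smooth.mdifferentiable (by simp) ξ
    have hsrc : ξ ∈ (chartAt (ModelProd (ModelProd E E) (E × E))
        (⟨⟨x, 0⟩, 0⟩ : T2 E M)).source := by
      have := mem_chartT2M_source.2 (show ξ.1.1 ∈ (chartAt E x).source from hx)
      rwa [extChartAt_source] at this
    set ν : TangentSpace 𝓘(ℝ, E).tangent.tangent ξ :=
      (((x', u'), (v', w')) : (E × E) × (E × E)) with hν
    have hf : sectionAct s.toFun ξ ∈ (chartAt (ModelProd (ModelProd E E) (E × E))
        (⟨⟨x, 0⟩, 0⟩ : T2 E M)).source := by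
      have := mem_chartT2M_source.2 (show (sectionAct s.toFun ξ).1.1 ∈ (chartAt E x).source by
        rw [hs1]; exact hx)
      rwa [extChartAt_source] at this
    have e1 := vcoord_tangentMap 𝓘(ℝ, E).tangent.tangent (x := (⟨⟨x, 0⟩, 0⟩ : T2 E M))
      hsd hf ν
    refine (vcoord_T2_self hs1 _).symm.trans (e1.trans ?_)
    set S : (E × E) × (E × E) → (E × E) × (E × E) :=
      fun q => ((q.1.1, -q.1.2), (-q.2.1, -q.2.2 + Γ q.1.1 q.2.1 q.1.2)) with hS
    have e2 : (fun η => chartT2M x (sectionAct s.toFun η)) =ᶠ[𝓝 ξ] S ∘ chartT2M x := by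
      filter_upwards [(chartAt _ (⟨⟨x, 0⟩, 0⟩ : T2 E M)).open_source.mem_nhds hsrc] with η hη
      rw [← extChartAt_source 𝓘(ℝ, E).tangent.tangent] at hη
      exact hΓ η (mem_chartT2M_source.1 hη) _ _ _ _ rfl
    rw [e2.mfderiv_eq]
    have hc : chartT2M x ξ = ((z, u), (v, w)) := chartT2M_self x u v w
    have f11 : HasFDerivAt (fun q : (E × E) × (E × E) => q.1.1) _ ((z, u), (v, w)) :=
      ((ContinuousLinearMap.fst ℝ E E).comp (ContinuousLinearMap.fst ℝ (E × E) (E × E))).hasFDerivAt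
    have f12 : HasFDerivAt (fun q : (E × E) × (E × E) => q.1.2) _ ((z, u), (v, w)) :=
      ((ContinuousLinearMap.snd ℝ E E).comp (ContinuousLinearMap.fst ℝ (E × E) (E × E))).hasFDerivAt
    have f21 : HasFDerivAt (fun q : (E × E) × (E × E) => q.2.1) _ ((z, u), (v, w)) :=
      ((ContinuousLinearMap.fst ℝ E E).comp (ContinuousLinearMap.snd ℝ (E × E) (E × E))).hasFDerivAt
    have f22 : HasFDerivAt (fun q : (E × E) × (E × E) => q.2.2) _ ((z, u), (v, w)) :=
      ((ContinuousLinearMap.snd ℝ E E).comp (ContinuousLinearMap.snd ℝ (E × E) (E × E))).hasFDerivAt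
    have fΓ : HasFDerivAt (fun q : (E × E) × (E × E) => Γ q.1.1) _ ((z, u), (v, w)) :=
      HasFDerivAt.comp (g := Γ) ((z, u), (v, w)) hd.hasFDerivAt f11
    have fS : HasFDerivAt S _ ((z, u), (v, w)) :=
      (f11.prodMk f12.neg).prodMk (f21.neg.prodMk (f22.neg.add ((fΓ.clm_apply f21).clm_apply f12)))
    have e3 := mfderiv_comp ξ (by rw [hc]; exact fS.differentiableAt.mdifferentiableAt)
      (mdifferentiableAt_extChartAt (I := 𝓘(ℝ, E).tangent.tangent) hsrc)
    refine (DFunLike.congr_fun e3 ν).trans ?_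
    rw [mfderiv_eq_fderiv]
    have e4 : @Eq ((E × E) × (E × E)) (mfderiv 𝓘(ℝ, E).tangent.tangent
      𝓘(ℝ, (E × E) × (E × E)) (chartT2M x) ξ ν) ν := vcoord_T2_self (x := x) rfl ν
    have e5 := (congrArg (fderiv ℝ S) hc).trans fS.fderiv
    refine (DFunLike.congr_arg _ e4).trans ((DFunLike.congr_fun e5 _).trans ?_)
    refine Prod.ext rfl (Prod.ext rfl ?_)
    change -w' + (Γ z v u' + (Γ z v' u + fderiv ℝ Γ z x' v u)) = _
    refine congrArg (-w' + ·) ?_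
    rw [add_comm (Γ z v u'), add_comm (Γ z v' u)]

theorem IsSymbol.kappaJetAct_point3 (hΓ : s.IsSymbol x Γ)
    (hd : DifferentiableAt ℝ Γ (extChartAt 𝓘(ℝ, E) x x)) (u v w x' u' v' w' : E) :
    s.kappaJetAct (point3 x u v w x' u' v' w') =
      point3 x (-u) v (-w) (-x') (-u' + Γ (extChartAt 𝓘(ℝ, E) x x) x' u) (-v')
        (-w' + (fderiv ℝ Γ (extChartAt 𝓘(ℝ, E) x x) v x' u + Γ (extChartAt 𝓘(ℝ, E) x x) v' u +
          Γ (extChartAt 𝓘(ℝ, E) x x) x' w)) := by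
  rw [kappaJetAct, kappa_point3, hΓ.jetAct_point3 hd, kappa_point3]

/-- The actions of `κ(j¹_x 𝔰)` and of `j¹_x 𝔰` on `T³M` commute up to a translation in the fibre of
the three projections to `T²M`. -/
theorem IsSymbol.jetAct_commutator (hΓ : s.IsSymbol x Γ)
    (hd : DifferentiableAt ℝ Γ (extChartAt 𝓘(ℝ, E) x x)) (u v w x' u' v' w' : E) :
    ∃ w₀ u₀ w₁ w₂ : E,
      s.kappaJetAct (s.jetAct (point3 x u v w x' u' v' w')) =
        point3 x u (-v) w₀ (-x') u₀ v' w₁ ∧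
      s.jetAct (s.kappaJetAct (point3 x u v w x' u' v' w')) =
        point3 x u (-v) w₀ (-x') u₀ v' w₂ ∧
      w₁ - w₂ =
        (2 : ℝ) • fderiv ℝ Γ (extChartAt 𝓘(ℝ, E) x x) v x' u -
        (2 : ℝ) • fderiv ℝ Γ (extChartAt 𝓘(ℝ, E) x x) x' v u +
        Γ (extChartAt 𝓘(ℝ, E) x x) x' (Γ (extChartAt 𝓘(ℝ, E) x x) v u) -
        Γ (extChartAt 𝓘(ℝ, E) x x) v (Γ (extChartAt 𝓘(ℝ, E) x x) x' u) := by
  rw [hΓ.jetAct_point3 hd, hΓ.kappaJetAct_point3 hd, hΓ.kappaJetAct_point3 hd,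
    hΓ.jetAct_point3 hd]
  -- From here only multilinear algebra in the value and the derivative of `Γ` at one point remains.
  generalize Γ (extChartAt 𝓘(ℝ, E) x x) = G
  generalize fderiv ℝ Γ (extChartAt 𝓘(ℝ, E) x x) = D
  have hD₁ : ∀ a b c, D (-a) b c = -(D a b c) := fun a b c =>
    congrArg (fun L : E →L[ℝ] E →L[ℝ] E => L b c) (D.map_neg a)
  have hD₂ : ∀ a b c, D a b (-c) = -(D a b c) := fun a b c => (D a b).map_neg c
  have hG₁ : ∀ a b, G (-a) b = -(G a b) := G.map_neg₂
  have hG₂ : ∀ a b, G a (-b) = -(G a b) := fun a b => (G a).map_neg b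
  have hG₃ : ∀ a b c, G a (b + c) = G a b + G a c := fun a b c => (G a).map_add b c
  simp only [hD₁, hD₂, hG₁, hG₂, hG₃, neg_neg]
  have h₁ : w + -(G v u) = -(-w + G v u) := by abel
  have h₂ : -(-u' + G x' u) = u' + -(G x' u) := by abel
  -- The two orders of composition give the same `w` and `u'` entries in different forms; once these
  -- coincide syntactically, `w₀` and `u₀` are shared.
  rw [h₁, h₂]
  exact ⟨_, _, _, _, rfl, rfl, by module⟩

end SymmetryJet

end SymJet

theorem theorem5p1 {E : Type*} [NormedAddCommGroup E] [NormedSpace ℝ E] [FiniteDimensional ℝ E]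
    {M : Type*} [TopologicalSpace M] [ChartedSpace E M] [IsManifold 𝓘(ℝ, E) ∞ M]
    (s : SymJet.SymmetryJet E M) (X Y Z : ∀ x : M, TangentSpace 𝓘(ℝ, E) x)
    (hX : ContMDiff 𝓘(ℝ, E) 𝓘(ℝ, E).tangent ∞ (SymJet.toSection X))
    (hY : ContMDiff 𝓘(ℝ, E) 𝓘(ℝ, E).tangent ∞ (SymJet.toSection Y))
    (hZ : ContMDiff 𝓘(ℝ, E) 𝓘(ℝ, E).tangent ∞ (SymJet.toSection Z)) (x : M) :
    SymJet.projections (s.kappaJetAct (s.jetAct (SymJet.thirdVector X Y Z x))) =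
        SymJet.projections (s.jetAct (s.kappaJetAct (SymJet.thirdVector X Y Z x))) ∧
      SymJet.toSection (s.curvature X Y Z) x =
        SymJet.scale (1 / 4)
          (SymJet.Pi3 (s.kappaJetAct (s.jetAct (SymJet.thirdVector X Y Z x)))
            (s.jetAct (s.kappaJetAct (SymJet.thirdVector X Y Z x)))) := by
  have : CompleteSpace E := FiniteDimensional.complete ℝ E
  obtain ⟨Γ, hΓs, hΓ⟩ := s.exists_christoffel x
  replace hΓ : s.IsSymbol x Γ := hΓ
  have hd : DifferentiableAt ℝ Γ (extChartAt 𝓘(ℝ, E) x x) :=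
    (hΓs.contDiffAt (extChartAt_target_mem_nhds x)).differentiableAt (by simp)
  obtain ⟨u, v, w, x', u', v', w', h3, hu, hv, hx'⟩ := SymJet.exists_thirdVector_eq_point3 (X := X) hY hZ x
  have hR := hΓ.curvature_eq hd hX hY hZ
  obtain ⟨w₀, u₀, w₁, w₂, h₁, h₂, h₁₂⟩ := hΓ.jetAct_commutator hd u v w x' u' v' w'
  rw [h3, h₁, h₂]
  constructor
  -- Translating the second point by `w₁ - w₂` gives the first, and translations preserve the three
  -- projections.
  · have h := SymJet.projections_translate (SymJet.point3 x u (-v) w₀ (-x') u₀ v' w₂)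
      (show E from w₁ - w₂)
    rwa [SymJet.translate_point3, add_sub_cancel] at h
  · rw [SymJet.Pi3_point3]
    refine SymJet.T1_ext rfl (hR.trans (congrArg ((1 / 4 : ℝ) • ·) ?_))
    rw [h₁₂, hu, hv, hx']
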